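/- Let $G$ be the free group on two generators $x,y$, let $z=x^{-1}y^{-1}xy$, and let $\sigma$ be the automorphism of $G$ with $\sigma(x)=yx$, $\sigma(y)=yxy$ (so $\sigma(z)=z$). Let $M_0$, respectively $M_1$, be the submonoid of $G$ generated by $x,y,z$, respectively by $x,y,z,z^{-1}$, and for $i=0,1$ let $M_{(i)}$ be the submonoid of all $a\in G$ such that $\sigma^n(a)\in M_i$ for some $n\ge 0$. Let $\delta:G\to\mathbb{Z}\times\mathbb{Z}$ be the homomorphism with $\delta(x)=(1,0)$, $\delta(y)=(0,1)$. For a monoid $M\subseteq G$ and a division ring $D$, let $DM$ be the monoid ring (elements of $D$ commuting with elements of $M$), graded by $\mathbb{Z}\times\mathbb{Z}$ with $DM_\alpha$ the $D$-span of $\{c\in M\mid\delta(c)=\alpha\}$. If $R$ is a ring graded by a group $A$ (written additively), a homogeneous $m$-term linear relation in $R$ is a relation $\sum_{i=1}^m u_iv_i=0$ together with $\alpha_1,\dots,\alpha_m,\beta\in A$ such that $u_i\in R_{\alpha_i}$ and $v_i\in R_{-\alpha_i+\beta}$ for all $i$. It is homogeneously trivializable if there is an invertible $m\times m$ matrix $T=(T_{ij})$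 over $R$ with $T_{ij}\in R_{-\alpha_i+\alpha_j}$ for all $i,j$ such that, writing $(u'_i)=(u_i)T$ (row vectors) and $(v'_i)=T^{-1}(v_i)$ (column vectors), for each $i$ one has $u'_i=0$ or $v'_i=0$. The graded ring $R$ is a homogeneous $n$-fir if every homogeneous linear relation of at most $n$ terms is homogeneously trivializable, and a homogeneous semifir if this holds for every positive integer $n$. For $DM$ with the grading induced by $\delta$ we say $\delta$-homogeneous semifir. **Lemma.** Let $M=M_{(0)}$ or $M=M_{(1)}$. Then for every division ring $D$, the $\mathbb{Z}\times\mathbb{Z}$-graded ring $DM$ is a $\delta$-homogeneous semifir. -/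

import Mathlib

/-! ### Homogeneous `n`-firs and homogeneous semifirs -/

section HomogeneousFirs

/-- A homogeneous `m`-term linear relation in a graded ring:
`∑ i, u i * v i = 0` with `u i` of degree `α i` and `v i` of degree `-α i + β`. -/
structure IsHomogeneousRelation {A R S : Type*} [AddGroup A] [Ring R] [SetLike S R]
    (𝒜 : A → S) {m : ℕ} (u v : Fin m → R) (α : Fin m → A) (β : A) : Prop where
  left_mem : ∀ i, u i ∈ 𝒜 (α i)
  right_mem : ∀ i, v i ∈ 𝒜 (-α i + β)
  sum_eq_zero : ∑ i, u i * v i = 0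

/-- A linear relation `u · v = 0` is trivial if for each `i` one of `u i`, `v i` is zero. -/
def IsTrivialRelation {R : Type*} [Ring R] {m : ℕ} (u v : Fin m → R) : Prop :=
  ∀ i, u i = 0 ∨ v i = 0

open scoped Matrix in
/-- The invertible matrix `T` trivializes the relation `u · v = 0` if the
relation `(u T) · (T⁻¹ v) = 0` is trivial. -/
def Trivializes {R : Type*} [Ring R] {m : ℕ} (T : (Matrix (Fin m) (Fin m) R)ˣ)
    (u v : Fin m → R) : Prop :=
  IsTrivialRelation (u ᵥ* T.val) (T⁻¹.val *ᵥ v)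

/-- A relation with left degrees `α` is homogeneously trivializable if it is trivialized by an
invertible matrix whose `(i, j)` entry is homogeneous of degree `-α i + α j`. -/
def IsHomogeneouslyTrivializable {A R S : Type*} [AddGroup A] [Ring R] [SetLike S R]
    (𝒜 : A → S) {m : ℕ} (u v : Fin m → R) (α : Fin m → A) : Prop :=
  ∃ T : (Matrix (Fin m) (Fin m) R)ˣ,
    (∀ i j, T.val i j ∈ 𝒜 (-α i + α j)) ∧ Trivializes T u v

/-- A graded ring is a homogeneous `n`-fir if every homogeneous linear relation of at most `n`
terms is homogeneously trivializable. -/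
def IsHomogeneousNFir {A R S : Type*} [DecidableEq A] [AddGroup A] [Ring R] [SetLike S R]
    [AddSubmonoidClass S R] (𝒜 : A → S) [GradedRing 𝒜] (n : ℕ) : Prop :=
  ∀ m ≤ n, ∀ (u v : Fin m → R) (α : Fin m → A) (β : A),
    IsHomogeneousRelation 𝒜 u v α β → IsHomogeneouslyTrivializable 𝒜 u v α

/-- A graded ring is a homogeneous semifir if it is a homogeneous `n`-fir for every
positive integer `n`. -/
def IsHomogeneousSemifir {A R S : Type*} [DecidableEq A] [AddGroup A] [Ring R] [SetLike S R]
    [AddSubmonoidClass S R] (𝒜 : A → S) [GradedRing 𝒜] : Prop :=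
  ∀ n : ℕ, 0 < n → IsHomogeneousNFir 𝒜 n

end HomogeneousFirs

/-! ### The grading of a monoid ring induced by a homomorphism to a group -/

section MonoidRingGrading

/-- For a homomorphism `h : M → A`, the elements of the monoid ring `D M` supported in
`{c | h c = α}`; see `homogeneousComponent_eq_span`. -/
def homogeneousComponent (D : Type*) {M A : Type*} [DivisionRing D] [Monoid M] [AddGroup A]
    (h : M →* Multiplicative A) (α : A) : Submodule D (MonoidAlgebra D M) where
  carrier := {f | ∀ c, f.coeff c ≠ 0 → h c = Multiplicative.ofAdd α}
  zero_mem' := fun c hc => absurd rfl hc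
  add_mem' := by
    intro f g hf hg c hc
    by_cases h0 : f.coeff c = 0
    · refine hg c fun h1 => hc ?_
      simp [h0, h1]
    · exact hf c h0
  smul_mem' := by
    intro d f hf c hc
    refine hf c fun h0 => hc ?_
    simp [h0]

theorem mem_homogeneousComponent {D M A : Type*} [DivisionRing D] [Monoid M] [AddGroup A]
    {h : M →* Multiplicative A} {α : A} {f : MonoidAlgebra D M} :
    f ∈ homogeneousComponent D h α ↔ ∀ c, f.coeff c ≠ 0 → h c = Multiplicative.ofAdd α :=
  Iff.rfl

theorem single_mem_homogeneousComponent {D M A : Type*} [DivisionRing D] [Monoid M] [AddGroup A]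
    (h : M →* Multiplicative A) {α : A} {c : M} (hc : h c = Multiplicative.ofAdd α) (d : D) :
    MonoidAlgebra.single c d ∈ homogeneousComponent D h α := by
  classical
  intro c' hc'
  rw [MonoidAlgebra.coeff_single, Finsupp.single_apply] at hc'
  split_ifs at hc' with hcc
  · rw [← hcc, hc]
  · exact absurd rfl hc'

/-- The homogeneous component of degree `α` is the `D`-span of `{c ∈ M | h c = α}`. -/
theorem homogeneousComponent_eq_span (D : Type*) {M A : Type*} [DivisionRing D] [Monoid M]
    [AddGroup A] (h : M →* Multiplicative A) (α : A) :
    homogeneousComponent D h α =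
      Submodule.span D (MonoidAlgebra.of D M '' {c | h c = Multiplicative.ofAdd α}) := by
  apply le_antisymm
  · intro f hf
    have hsum : f = ∑ c ∈ f.coeff.support, MonoidAlgebra.single c (f.coeff c) := by
      apply MonoidAlgebra.coeff_injective
      simp only [MonoidAlgebra.coeff_sum, MonoidAlgebra.coeff_single]
      exact (Finsupp.sum_single f.coeff).symm
    rw [hsum]
    refine Submodule.sum_mem _ fun c hc => ?_
    have h1 : MonoidAlgebra.single c (f.coeff c) = f.coeff c • MonoidAlgebra.of D M c := by
      simp [MonoidAlgebra.of_apply]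
    rw [h1]
    exact Submodule.smul_mem _ _
      (Submodule.subset_span ⟨c, hf c (Finsupp.mem_support_iff.1 hc), rfl⟩)
  · rw [Submodule.span_le]
    rintro _ ⟨c, hc, rfl⟩
    exact single_mem_homogeneousComponent h hc 1

instance homogeneousComponent.gradedMonoid (D : Type*) {M A : Type*} [DivisionRing D] [Monoid M]
    [AddGroup A] (h : M →* Multiplicative A) : SetLike.GradedMonoid (homogeneousComponent D h) where
  one_mem := by
    rw [MonoidAlgebra.one_def]
    exact single_mem_homogeneousComponent h (by simp) 1
  mul_mem := by
    intro α β f g hf hg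
    rw [homogeneousComponent_eq_span] at hf hg
    induction hf using Submodule.span_induction with
    | zero => simp
    | add f₁ f₂ _ _ h₁ h₂ => rw [add_mul]; exact add_mem h₁ h₂
    | smul d f _ h₁ =>
      rw [smul_mul_assoc]
      exact Submodule.smul_mem _ _ h₁
    | mem f hf =>
      obtain ⟨c, hc, rfl⟩ := hf
      rw [← homogeneousComponent_eq_span] at hg
      have hsum : g = ∑ b ∈ g.coeff.support, MonoidAlgebra.single b (g.coeff b) := by
        apply MonoidAlgebra.coeff_injective
        simp only [MonoidAlgebra.coeff_sum, MonoidAlgebra.coeff_single]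
        exact (Finsupp.sum_single g.coeff).symm
      rw [hsum, Finset.mul_sum]
      refine Submodule.sum_mem _ fun b hb => ?_
      rw [MonoidAlgebra.of_apply, MonoidAlgebra.single_mul_single]
      refine single_mem_homogeneousComponent h ?_ _
      rw [map_mul, hg b (Finsupp.mem_support_iff.1 hb), hc.out, ofAdd_add]

/-- The decomposition of an element of `D M` into its homogeneous components. -/
noncomputable def homogeneousComponent.decomposeHom (D : Type*) {M A : Type*} [DivisionRing D]
    [Monoid M] [AddGroup A] [DecidableEq A] (h : M →* Multiplicative A) :
    MonoidAlgebra D M →+ DirectSum A fun α => homogeneousComponent D h α :=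
  (Finsupp.liftAddHom fun c =>
    (DirectSum.of (fun α => homogeneousComponent D h α) (h c).toAdd).comp
      { toFun := fun d => ⟨MonoidAlgebra.single c d,
          single_mem_homogeneousComponent h (ofAdd_toAdd _).symm d⟩
        map_zero' := by ext; simp
        map_add' := fun d d' => by ext; simp }).comp
    MonoidAlgebra.coeffAddEquiv.toAddMonoidHom

theorem homogeneousComponent.decomposeHom_single (D : Type*) {M A : Type*} [DivisionRing D]
    [Monoid M] [AddGroup A] [DecidableEq A] (h : M →* Multiplicative A) {α : A} {c : M}
    (hc : h c = Multiplicative.ofAdd α) (d : D) :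
    homogeneousComponent.decomposeHom D h (MonoidAlgebra.single c d) =
      DirectSum.of (fun α => homogeneousComponent D h α) α
        ⟨MonoidAlgebra.single c d, single_mem_homogeneousComponent h hc d⟩ := by
  obtain rfl : (h c).toAdd = α := by rw [hc, toAdd_ofAdd]
  exact Finsupp.liftAddHom_apply_single _ _ _

noncomputable instance homogeneousComponent.gradedRing (D : Type*) {M A : Type*} [DivisionRing D]
    [Monoid M] [AddGroup A] [DecidableEq A] (h : M →* Multiplicative A) :
    GradedRing (homogeneousComponent D h) where
  toDecomposition := DirectSum.Decomposition.ofAddHom _ (homogeneousComponent.decomposeHom D h)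
    (by
      refine AddMonoidHom.ext fun f => ?_
      induction f using MonoidAlgebra.induction_linear with
      | zero => simp
      | add f g hf hg => rw [map_add, hf, hg, map_add]
      | single c d =>
        rw [AddMonoidHom.comp_apply, homogeneousComponent.decomposeHom_single D h
          (ofAdd_toAdd _).symm]
        simp)
    (by
      ext α f : 2
      obtain ⟨f, hf⟩ := f
      have hsum : f = ∑ b ∈ f.coeff.support, MonoidAlgebra.single b (f.coeff b) := by
        apply MonoidAlgebra.coeff_injective
        simp only [MonoidAlgebra.coeff_sum, MonoidAlgebra.coeff_single]
        exact (Finsupp.sum_single f.coeff).symm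
      have hsub : (⟨f, hf⟩ : homogeneousComponent D h α) =
          ∑ b ∈ f.coeff.support.attach, ⟨MonoidAlgebra.single b.1 (f.coeff b.1),
            single_mem_homogeneousComponent h (hf b.1 (Finsupp.mem_support_iff.1 b.2)) _⟩ := by
        apply Subtype.ext
        rw [AddSubmonoidClass.coe_finsetSum]
        rw [Finset.sum_attach f.coeff.support
          fun b => MonoidAlgebra.single b (f.coeff b)]
        exact hsum
      rw [hsub, map_sum, map_sum]
      refine Finset.sum_congr rfl fun b _ => ?_
      simp only [AddMonoidHom.comp_apply, AddMonoidHom.id_apply,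
        DirectSum.coeAddMonoidHom_of]
      exact homogeneousComponent.decomposeHom_single D h
        (hf b.1 (Finsupp.mem_support_iff.1 b.2)) _)

end MonoidRingGrading

/-! ### The two monoids -/

section CedoMonoids

/-- `G`, the free group on two generators. -/
abbrev CedoG : Type := FreeGroup (Fin 2)

namespace CedoG

/-- The first free generator of `G`. -/
def x : CedoG := FreeGroup.of 0

/-- The second free generator of `G`. -/
def y : CedoG := FreeGroup.of 1

/-- The commutator `z = x⁻¹ y⁻¹ x y`. -/
def z : CedoG := x⁻¹ * y⁻¹ * x * y

/-- The submonoid of `G` generated by `x`, `y`, `z`. -/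
def M₀ : Submonoid CedoG := Submonoid.closure {x, y, z}

/-- The submonoid of `G` generated by `x`, `y`, `z`, `z⁻¹`. -/
def M₁ : Submonoid CedoG := Submonoid.closure {x, y, z, z⁻¹}

/-- The automorphism `σ` of `G` with `σ x = y x` and `σ y = y x y`. -/
def σ : MulAut CedoG :=
  MonoidHom.toMulEquiv
    (FreeGroup.lift ![y * x, y * x * y])
    (FreeGroup.lift ![y⁻¹ * x * x, x⁻¹ * y])
    (by
      ext i
      fin_cases i <;> simp [x, y, mul_assoc])
    (by
      ext i
      fin_cases i <;> simp [x, y, mul_assoc])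

theorem σ_x : σ x = y * x := by simp [σ, x]

theorem σ_y : σ y = y * x * y := by simp [σ, y]

theorem σ_z : σ z = z := by
  simp only [z, map_mul, map_inv, σ_x, σ_y]
  group

theorem σ_mem_M₀ {a : CedoG} (ha : a ∈ M₀) : σ a ∈ M₀ := by
  have hx : x ∈ M₀ := Submonoid.subset_closure (by simp)
  have hy : y ∈ M₀ := Submonoid.subset_closure (by simp)
  have hz : z ∈ M₀ := Submonoid.subset_closure (by simp)
  have h : M₀ ≤ M₀.comap (σ : CedoG →* CedoG) := by
    refine Submonoid.closure_le.2 ?_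
    rintro _ (rfl | rfl | rfl)
    · exact (σ_x ▸ mul_mem hy hx : σ x ∈ M₀)
    · exact (σ_y ▸ mul_mem (mul_mem hy hx) hy : σ y ∈ M₀)
    · exact (σ_z.symm ▸ hz : σ z ∈ M₀)
  exact h ha

theorem σ_mem_M₁ {a : CedoG} (ha : a ∈ M₁) : σ a ∈ M₁ := by
  have hx : x ∈ M₁ := Submonoid.subset_closure (by simp)
  have hy : y ∈ M₁ := Submonoid.subset_closure (by simp)
  have hz : z ∈ M₁ := Submonoid.subset_closure (by simp)
  have hz' : z⁻¹ ∈ M₁ := Submonoid.subset_closure (by simp)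
  have h : M₁ ≤ M₁.comap (σ : CedoG →* CedoG) := by
    refine Submonoid.closure_le.2 ?_
    rintro _ (rfl | rfl | rfl | rfl)
    · exact (σ_x ▸ mul_mem hy hx : σ x ∈ M₁)
    · exact (σ_y ▸ mul_mem (mul_mem hy hx) hy : σ y ∈ M₁)
    · exact (σ_z.symm ▸ hz : σ z ∈ M₁)
    · have : σ z⁻¹ = z⁻¹ := by rw [map_inv, σ_z]
      exact (this.symm ▸ hz' : σ z⁻¹ ∈ M₁)
  exact h ha

theorem σ_pow_mem {N : Submonoid CedoG} (hN : ∀ a ∈ N, σ a ∈ N) {m n : ℕ} (hmn : m ≤ n)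
    {a : CedoG} (ha : (σ ^ m) a ∈ N) : (σ ^ n) a ∈ N := by
  induction n, hmn using Nat.le_induction with
  | base => exact ha
  | succ k _ ih =>
    rw [pow_succ', MulAut.mul_apply]
    exact hN _ ih

/-- For a submonoid `N` carried into itself by `σ`, the submonoid of all `a ∈ G` with
`σ ^ n a ∈ N` for some `n`. -/
def limitSubmonoid (N : Submonoid CedoG) (hN : ∀ a ∈ N, σ a ∈ N) : Submonoid CedoG where
  carrier := {a | ∃ n : ℕ, (σ ^ n) a ∈ N}
  one_mem' := ⟨0, by simp⟩
  mul_mem' := by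
    rintro a b ⟨m, hm⟩ ⟨n, hn⟩
    refine ⟨max m n, ?_⟩
    rw [map_mul]
    exact mul_mem (σ_pow_mem hN (le_max_left m n) hm) (σ_pow_mem hN (le_max_right m n) hn)

/-- `M_(0)`: the set of `a ∈ G` such that `σ ^ n a ∈ M₀` for some `n`. -/
def Mlim₀ : Submonoid CedoG := limitSubmonoid M₀ fun _ => σ_mem_M₀

/-- `M_(1)`: the set of `a ∈ G` such that `σ ^ n a ∈ M₁` for some `n`. -/
def Mlim₁ : Submonoid CedoG := limitSubmonoid M₁ fun _ => σ_mem_M₁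

/-- The homomorphism `δ : G → ℤ × ℤ` with `δ x = (1, 0)` and `δ y = (0, 1)`. -/
def δ : CedoG →* Multiplicative (ℤ × ℤ) :=
  FreeGroup.lift ![Multiplicative.ofAdd (1, 0), Multiplicative.ofAdd (0, 1)]

theorem δ_x : δ x = Multiplicative.ofAdd (1, 0) := by simp [δ, x]

theorem δ_y : δ y = Multiplicative.ofAdd (0, 1) := by simp [δ, y]

end CedoG

end CedoMonoids

/-! Degrees are ordered by the injective form `slope`, (p, q) ↦ p + qφ with φ the golden ratio,
which is nonnegative on M. The ring-theoretic half uses only the properties collected in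
`IsCyclicTransversal`: an element of M can be cut at every degree between that of 1 and its own; the
cut is unique once the right factor is normalized to lie in C; and the elements of degree zero are
essentially powers of z.

Let ∑ uᵢvᵢ = 0, and let α₀ be the largest degree of a uᵢ among the nonvanishing terms. Left
multiplication does not affect normalized right factors, so extracting the left coefficient of a
suitable c ∈ C of degree −α₀ + β gives ∑ uᵢwᵢ = 0. Where αᵢ = α₀, the wᵢ become polynomials in z
after multiplication by a power of z, and they are not all zero. Euclid's algorithm, run through
column operations, leaves a single such polynomial p, so uᵢp(z) lies in the right ideal generated by
the uⱼ of smaller degree. Above the degrees of its generators, the quotient by that ideal has no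
torsion over D[z] (`mem_homogeneousRightSpan_of_mul`). Hence uᵢ lies in the ideal, a column
operation kills it, and induction on the number of nonvanishing terms finishes.

Cuts exist in the limit monoids because σ acts on degrees with eigenvalues φ² and φ⁻². The prefixes
of σⁿ(x) and σⁿ(y) stay in a strip along the expanding line which is thin enough to contain at most
one lattice point of each coordinate sum, and every degree enters that strip under iteration
(`exists_split_letter`). Cuts are unique up to a power of z because a crossed homomorphism from G to
functions on ℤ², `latticeFun`, determines an element of M₁ of given degree, and the supports of two
consecutive factors meet in at most one point (`exists_zpow_of_mul_eq`). -/

/-! ### Homogeneous column operations -/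

section ColumnOperations

open scoped Matrix

/-- The invertible matrix which adds to column `i` the combination of the columns with
coefficients `r`. -/
def columnUnit {R ι : Type*} [Ring R] [Fintype ι] [DecidableEq ι] (i : ι) (r : ι → R)
    (hr : r i = 0) : (Matrix ι ι R)ˣ where
  val := 1 + Matrix.of fun j k => if k = i then r j else 0
  inv := 1 - Matrix.of fun j k => if k = i then r j else 0
  val_inv := by
    have h : (Matrix.of fun j k => if k = i then r j else 0) *
        (Matrix.of fun j k => if k = i then r j else 0) = 0 := by
      ext j k
      simp [Matrix.mul_apply, hr]
    rw [add_mul, mul_sub, mul_sub, one_mul, h]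
    simp
  inv_val := by
    have h : (Matrix.of fun j k => if k = i then r j else 0) *
        (Matrix.of fun j k => if k = i then r j else 0) = 0 := by
      ext j k
      simp [Matrix.mul_apply, hr]
    rw [sub_mul, mul_add, mul_add, one_mul, h]
    simp

theorem vecMul_columnUnit {R ι : Type*} [Ring R] [Fintype ι] [DecidableEq ι] (i : ι) (r : ι → R)
    (hr : r i = 0) (u : ι → R) :
    u ᵥ* (columnUnit i r hr).val = Function.update u i (u i + ∑ j, u j * r j) := by
  ext k
  by_cases hk : k = i
  · subst hk
    simp [columnUnit, Matrix.vecMul, dotProduct, Matrix.one_apply, mul_add, Finset.sum_add_distrib]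
  · simp [columnUnit, Matrix.vecMul, dotProduct, Matrix.one_apply, hk]

theorem columnUnit_inv_mulVec {R ι : Type*} [Ring R] [Fintype ι] [DecidableEq ι] (i : ι)
    (r : ι → R) (hr : r i = 0) (v : ι → R) :
    (columnUnit i r hr)⁻¹.val *ᵥ v = fun j => v j - r j * v i := by
  ext k
  change ((1 - Matrix.of fun j k => if k = i then r j else 0) *ᵥ v) k = _
  simp [Matrix.mulVec, dotProduct, Matrix.one_apply, sub_mul, Finset.sum_sub_distrib]

variable {A R S : Type*} [AddGroup A] [Ring R] [SetLike S R] [AddSubgroupClass S R]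
  {𝒜 : A → S} [SetLike.GradedMonoid 𝒜] {m : ℕ} {u v : Fin m → R} {α : Fin m → A} {β : A}

/-- Trivializing matrices compose. This reduces a relation to its transform under an elementary
operation. -/
theorem isHomogeneouslyTrivializable_of_columnOperation (i : Fin m) (r : Fin m → R)
    (hr : r i = 0) (hmem : ∀ j, r j ∈ 𝒜 (-α j + α i))
    (H : IsHomogeneouslyTrivializable 𝒜 (Function.update u i (u i + ∑ j, u j * r j))
      (fun j => v j - r j * v i) α) :
    IsHomogeneouslyTrivializable 𝒜 u v α := by
  obtain ⟨T, hT, h⟩ := H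
  refine ⟨columnUnit i r hr * T, fun j k => ?_, ?_⟩
  · rw [Units.val_mul, Matrix.mul_apply]
    refine sum_mem fun l _ => ?_
    have h1 : (columnUnit i r hr).val j l ∈ 𝒜 (-α j + α l) := by
      change (1 + Matrix.of fun j k => if k = i then r j else 0) j l ∈ _
      rw [Matrix.add_apply, Matrix.of_apply]
      refine add_mem ?_ ?_
      · by_cases hjl : j = l
        · subst hjl
          simpa using SetLike.GradedOne.one_mem (A := 𝒜)
        · rw [Matrix.one_apply_ne hjl]
          exact zero_mem _
      · split_ifs with hl
        · subst hl
          exact hmem j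
        · exact zero_mem _
    have h2 := SetLike.GradedMul.mul_mem h1 (hT l k)
    simpa [add_assoc] using h2
  · rw [Trivializes, mul_inv_rev, Units.val_mul, Units.val_mul, ← Matrix.vecMul_vecMul,
      ← Matrix.mulVec_mulVec, vecMul_columnUnit, columnUnit_inv_mulVec]
    exact h

theorem sum_columnOperation (i : Fin m) (r : Fin m → R) (hr : r i = 0) (w : Fin m → R) :
    ∑ j, Function.update u i (u i + ∑ j, u j * r j) j * (w j - r j * w i) = ∑ j, u j * w j := by
  have h := Matrix.dotProduct_mulVec (u ᵥ* (columnUnit i r hr).val) (columnUnit i r hr)⁻¹.val w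
  rw [Matrix.vecMul_vecMul, Units.mul_inv, Matrix.vecMul_one, vecMul_columnUnit,
    columnUnit_inv_mulVec] at h
  exact h

theorem IsHomogeneousRelation.columnOperation (h : IsHomogeneousRelation 𝒜 u v α β) (i : Fin m)
    (r : Fin m → R) (hr : r i = 0) (hmem : ∀ j, r j ∈ 𝒜 (-α j + α i)) :
    IsHomogeneousRelation 𝒜 (Function.update u i (u i + ∑ j, u j * r j))
      (fun j => v j - r j * v i) α β where
  left_mem k := by
    by_cases hk : k = i
    · subst hk
      rw [Function.update_self]
      refine add_mem (h.left_mem k) (sum_mem fun j _ => ?_)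
      simpa using SetLike.GradedMul.mul_mem (h.left_mem j) (hmem j)
    · rw [Function.update_of_ne hk]
      exact h.left_mem k
  right_mem j := by
    refine sub_mem (h.right_mem j) ?_
    simpa [add_assoc] using SetLike.GradedMul.mul_mem (hmem j) (h.right_mem i)
  sum_eq_zero := by rw [sum_columnOperation i r hr, h.sum_eq_zero]

theorem IsTrivialRelation.isHomogeneouslyTrivializable (h : IsTrivialRelation u v) :
    IsHomogeneouslyTrivializable 𝒜 u v α := by
  refine ⟨1, fun i j => ?_, ?_⟩
  · by_cases hij : i = j
    · subst hij
      simpa using SetLike.GradedOne.one_mem (A := 𝒜)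
    · rw [Units.val_one, Matrix.one_apply_ne hij]
      exact zero_mem _
  · simpa [Trivializes] using h

end ColumnOperations

/-! ### Monoid rings with a cyclic degree-zero part -/

section CyclicTransversal

open Polynomial

/-- Data for which every element of `M` has, for every admissible degree `γ`, a unique
right factor of degree `γ` in the transversal `C`, degrees are ordered through `s`, and
the elements of degree zero are essentially powers of `z`. -/
structure IsCyclicTransversal {M A : Type*} [Monoid M] [AddCommGroup A]
    (h : M →* Multiplicative A) (s : A →+ ℝ) (z : M) (e : M → ℤ) (C : Set M) : Prop where
  degree_injective : Function.Injective s
  nonneg : ∀ c, 0 ≤ s (h c).toAdd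
  exists_mul : ∀ b γ, 0 ≤ s γ → s γ ≤ s (h b).toAdd →
    ∃ a, ∃ c ∈ C, h c = Multiplicative.ofAdd γ ∧ a * c = b
  eq_of_mul_eq : ∀ {a a' c c'}, c ∈ C → c' ∈ C → h c = h c' → a * c = a' * c' → c = c'
  mul_mem : ∀ {c}, c ∈ C → h c ≠ 1 → c * z ∈ C
  degree_z : h z = 1
  index_mul : ∀ c, e (c * z) = e c + 1
  exists_pow : ∀ c, h c = 1 → ∃ N k : ℕ, c * z ^ N = z ^ k

/-! ### Right quotients and polynomials in z. -/

variable {D : Type*} [DivisionRing D] {M : Type*} [Monoid M]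

/-- The additive map of `D M` sending `a * c` to `a` and the elements outside `M c` to zero. -/
noncomputable def rightQuotient [IsRightCancelMul M] (c : M) :
    MonoidAlgebra D M →+ MonoidAlgebra D M where
  toFun r := MonoidAlgebra.ofCoeff
    (r.coeff.comapDomain (fun a => a * c) (mul_left_injective c).injOn)
  map_zero' := by ext; simp
  map_add' r r' := by ext; simp

@[simp]
theorem coeff_rightQuotient [IsRightCancelMul M] (c a : M) (r : MonoidAlgebra D M) :
    (rightQuotient c r).coeff a = r.coeff (a * c) := rfl

theorem rightQuotient_single_mul [IsRightCancelMul M] (c a : M) (d : D) :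
    rightQuotient c (MonoidAlgebra.single (a * c) d) = MonoidAlgebra.single a d := by
  classical
  ext b
  simp [Finsupp.single_apply]

theorem rightQuotient_single_of_ne [IsRightCancelMul M] {c b : M} (hb : ∀ a, a * c ≠ b) (d : D) :
    rightQuotient c (MonoidAlgebra.single b d) = 0 := by
  classical
  ext a
  simp [(hb a).symm]

/-- The homomorphism `D[X] → D M` with `X ↦ z`. -/
noncomputable def polynomialHom (D : Type*) [DivisionRing D] (z : M) : D[X] →+* MonoidAlgebra D M :=
  eval₂RingHom' MonoidAlgebra.singleOneRingHom (MonoidAlgebra.single z 1) fun a => by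
    simp [Commute, SemiconjBy, MonoidAlgebra.single_mul_single]

theorem polynomialHom_apply (z : M) (p : D[X]) :
    polynomialHom D z p =
      ∑ k ∈ Finset.range (p.natDegree + 1), MonoidAlgebra.single (z ^ k) (p.coeff k) := by
  simp [polynomialHom, eval₂RingHom', eval₂_eq_sum_range, MonoidAlgebra.single_pow,
    MonoidAlgebra.single_mul_single]

theorem polynomialHom_X_pow (z : M) (n : ℕ) :
    polynomialHom D z (X ^ n) = MonoidAlgebra.single (z ^ n) 1 := by
  simp [polynomialHom, eval₂RingHom', MonoidAlgebra.single_pow]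

theorem polynomialHom_C (z : M) (d : D) :
    polynomialHom D z (C d) = MonoidAlgebra.single 1 d := by
  simp [polynomialHom, eval₂RingHom']

theorem coeff_mul_single_mul_right [IsRightCancelMul M] (u : MonoidAlgebra D M) (b c : M) (d : D) :
    (u * MonoidAlgebra.single c d).coeff (b * c) = u.coeff b * d :=
  MonoidAlgebra.coeff_mul_single_eq_coeff_mul _ fun _ _ => mul_left_inj c

theorem coeff_mul_polynomialHom [IsRightCancelMul M] (z : M) (u : MonoidAlgebra D M) (p : D[X])
    (b : M) : (u * polynomialHom D z p).coeff (b * z ^ p.natDegree) =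
      ∑ k ∈ Finset.range (p.natDegree + 1), u.coeff (b * z ^ (p.natDegree - k)) * p.coeff k := by
  rw [polynomialHom_apply, Finset.mul_sum, MonoidAlgebra.coeff_sum, Finsupp.finsetSum_apply]
  refine Finset.sum_congr rfl fun k hk => ?_
  have hk' : p.natDegree - k + k = p.natDegree := by
    have := Finset.mem_range.1 hk
    omega
  rw [← coeff_mul_single_mul_right, mul_assoc, ← pow_add, hk']

section Degrees

variable {A : Type*} [AddCommGroup A] {h : M →* Multiplicative A} {s : A →+ ℝ} {z : M}
  {e : M → ℤ} {C : Set M}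

@[elab_as_elim]
theorem homogeneousComponent_induction {α : A} {p : MonoidAlgebra D M → Prop} (h0 : p 0)
    (hadd : ∀ x y, p x → p y → p (x + y))
    (hsingle : ∀ c d, h c = Multiplicative.ofAdd α → p (MonoidAlgebra.single c d))
    {x : MonoidAlgebra D M} (hx : x ∈ homogeneousComponent D h α) : p x := by
  rw [← MonoidAlgebra.sum_coeff_single x, Finsupp.sum]
  exact Finset.sum_induction _ p hadd h0 fun c hc =>
    hsingle c _ (hx c (Finsupp.mem_support_iff.1 hc))

theorem rightQuotient_mem [IsRightCancelMul M] {ε γ : A} {c : M}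
    (hc : h c = Multiplicative.ofAdd γ) {v : MonoidAlgebra D M}
    (hv : v ∈ homogeneousComponent D h (ε + γ)) :
    rightQuotient c v ∈ homogeneousComponent D h ε := by
  intro a ha
  have h1 := hv _ ha
  rw [map_mul, hc, ofAdd_add] at h1
  exact mul_right_cancel h1

theorem single_one_mem (d : D) : MonoidAlgebra.single 1 d ∈ homogeneousComponent D h 0 :=
  single_mem_homogeneousComponent h (by simp) d

namespace IsCyclicTransversal

variable (H : IsCyclicTransversal h s z e C)
include H

theorem eq_of_degree_eq {α α' : A} (hs : s α = s α') : α = α' := H.degree_injective hs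

theorem degree_z_pow (k : ℕ) : h (z ^ k) = 1 := by simp [H.degree_z]

theorem index_mul_pow (c : M) (k : ℕ) : e (c * z ^ k) = e c + k := by
  induction k with
  | zero => simp
  | succ k ih => rw [pow_succ, ← mul_assoc, H.index_mul, ih]; push_cast; ring

theorem mul_pow_mem {c : M} (hc : c ∈ C) (hc1 : h c ≠ 1) (k : ℕ) : c * z ^ k ∈ C := by
  induction k with
  | zero => simpa
  | succ k ih =>
    rw [pow_succ, ← mul_assoc]
    exact H.mul_mem ih (by rwa [map_mul, H.degree_z_pow, mul_one])

theorem polynomialHom_mem (p : D[X]) : polynomialHom D z p ∈ homogeneousComponent D h 0 := by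
  rw [polynomialHom_apply]
  exact sum_mem fun k _ => single_mem_homogeneousComponent h (by simp [H.degree_z]) _

theorem eq_zero_of_neg {α : A} (hα : s α < 0) {x : MonoidAlgebra D M}
    (hx : x ∈ homogeneousComponent D h α) : x = 0 := by
  by_contra hne
  have : x.coeff ≠ 0 := by simpa using hne
  obtain ⟨c, hc⟩ := Finsupp.ne_iff.1 this
  have := H.nonneg c
  rw [hx c hc, toAdd_ofAdd] at this
  linarith

/-- If b = a * c' with c' ∈ C of degree γ, then any multiple a₁ * b has the same normalized right
factor c', by uniqueness. The condition 0 ≤ s ε guarantees that every monomial of v is long enough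
to be cut. -/
theorem rightQuotient_mul [IsRightCancelMul M] {ε γ : A} {c : M} (hc : c ∈ C)
    (hcγ : h c = Multiplicative.ofAdd γ) (hε : 0 ≤ s ε) (u : MonoidAlgebra D M)
    {v : MonoidAlgebra D M} (hv : v ∈ homogeneousComponent D h (ε + γ)) :
    rightQuotient c (u * v) = u * rightQuotient c v := by
  refine homogeneousComponent_induction (x := v) ?_ (fun x y hx hy => ?_) ?_ hv
  · simp
  · rw [mul_add, map_add, map_add, mul_add, hx, hy]
  · intro b d hb
    induction u using MonoidAlgebra.induction_linear with
    | zero => simp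
    | add x y hx hy => rw [add_mul, map_add, add_mul, hx, hy]
    | single a₁ d₁ =>
      have hγ : 0 ≤ s γ := by simpa [hcγ] using H.nonneg c
      obtain ⟨a, c', hc', hcγ', rfl⟩ := H.exists_mul b γ hγ (by
        rw [hb, toAdd_ofAdd, map_add]
        linarith)
      rw [MonoidAlgebra.single_mul_single]
      by_cases hcc : c' = c
      · subst hcc
        rw [← mul_assoc, rightQuotient_single_mul, rightQuotient_single_mul,
          MonoidAlgebra.single_mul_single]
      · have key : ∀ a₀ a₂ : M, a₂ * c ≠ a₀ * c' := fun a₀ a₂ heq =>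
          hcc (H.eq_of_mul_eq hc hc' (hcγ.trans hcγ'.symm) heq).symm
        rw [← mul_assoc, rightQuotient_single_of_ne (key _), rightQuotient_single_of_ne (key _),
          mul_zero]

theorem exists_rightQuotient_ne_zero [IsRightCancelMul M] {ε γ : A} (hε : 0 ≤ s ε) (hγ : 0 ≤ s γ)
    {v : MonoidAlgebra D M} (hv : v ∈ homogeneousComponent D h (ε + γ)) (hv0 : v ≠ 0) :
    ∃ c ∈ C, h c = Multiplicative.ofAdd γ ∧ rightQuotient c v ≠ 0 := by
  have : v.coeff ≠ 0 := by simpa using hv0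
  obtain ⟨b, hb⟩ := Finsupp.ne_iff.1 this
  obtain ⟨a, c, hc, hcγ, rfl⟩ := H.exists_mul b γ hγ (by
    rw [hv b hb, toAdd_ofAdd, map_add]
    linarith)
  refine ⟨c, hc, hcγ, fun h0 => hb ?_⟩
  rw [← coeff_rightQuotient, h0]
  rfl

/-- A homogeneous element is recovered from its right quotients. -/
theorem exists_eq_sum_rightQuotient [IsRightCancelMul M] {ε γ : A} (hε : 0 ≤ s ε) (hγ : 0 ≤ s γ)
    {v : MonoidAlgebra D M} (hv : v ∈ homogeneousComponent D h (ε + γ)) :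
    ∃ T : Finset M, (∀ c ∈ T, c ∈ C ∧ h c = Multiplicative.ofAdd γ) ∧
      (∀ c ∈ C, h c = Multiplicative.ofAdd γ → c ∉ T → rightQuotient c v = 0) ∧
      v = ∑ c ∈ T, rightQuotient c v * MonoidAlgebra.single c 1 := by
  classical
  have key : ∀ T : Finset M, (∀ c ∈ T, c ∈ C ∧ h c = Multiplicative.ofAdd γ) →
      ∀ x : MonoidAlgebra D M, ∀ T' : Finset M, T' ⊆ T →
      (∀ c ∈ C, h c = Multiplicative.ofAdd γ → c ∉ T' → rightQuotient c x = 0) →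
      x = ∑ c ∈ T', rightQuotient c x * MonoidAlgebra.single c 1 →
      x = ∑ c ∈ T, rightQuotient c x * MonoidAlgebra.single c 1 := by
    intro T hT x T' hTT' h0 hx
    rw [← Finset.sum_subset hTT', ← hx]
    intro c hc hc'
    rw [h0 c (hT c hc).1 (hT c hc).2 hc', zero_mul]
  refine homogeneousComponent_induction (x := v) ?_ (fun x y hx hy => ?_) ?_ hv
  · exact ⟨∅, by simp, by simp, by simp⟩
  · obtain ⟨T₁, h₁, h₁', h₁''⟩ := hx
    obtain ⟨T₂, h₂, h₂', h₂''⟩ := hy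
    have hT : ∀ c ∈ T₁ ∪ T₂, c ∈ C ∧ h c = Multiplicative.ofAdd γ := by
      intro c hc
      rcases Finset.mem_union.1 hc with hc | hc
      · exact h₁ c hc
      · exact h₂ c hc
    refine ⟨T₁ ∪ T₂, hT, fun c hc hcγ hcT => ?_, ?_⟩
    · rw [Finset.mem_union, not_or] at hcT
      rw [map_add, h₁' c hc hcγ hcT.1, h₂' c hc hcγ hcT.2, add_zero]
    · simp only [map_add, add_mul, Finset.sum_add_distrib]
      rw [← key _ hT x T₁ Finset.subset_union_left h₁' h₁'',
        ← key _ hT y T₂ Finset.subset_union_right h₂' h₂'']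
  · intro b d hb
    obtain ⟨a, c, hc, hcγ, rfl⟩ := H.exists_mul b γ hγ (by
        rw [hb, toAdd_ofAdd, map_add]
        linarith)
    refine ⟨{c}, by simp [hc, hcγ], fun c' hc' hcγ' hcT => ?_, ?_⟩
    · refine rightQuotient_single_of_ne (fun a' heq => hcT ?_) d
      rw [Finset.mem_singleton]
      exact H.eq_of_mul_eq hc' hc (hcγ'.trans hcγ.symm) heq
    · rw [Finset.sum_singleton, rightQuotient_single_mul, MonoidAlgebra.single_mul_single, mul_one]

/-- A high power of z clears the negative exponents. The conclusion holds for all large n so that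
one exponent serves several elements. -/
theorem exists_polynomial {w : MonoidAlgebra D M} (hw : w ∈ homogeneousComponent D h 0) :
    ∃ N : ℕ, ∀ n ≥ N, ∃ p : D[X], w * MonoidAlgebra.single (z ^ n) 1 = polynomialHom D z p := by
  refine homogeneousComponent_induction (x := w) ?_ (fun x y hx hy => ?_) ?_ hw
  · exact ⟨0, fun n _ => ⟨0, by simp⟩⟩
  · obtain ⟨N₁, h₁⟩ := hx
    obtain ⟨N₂, h₂⟩ := hy
    refine ⟨max N₁ N₂, fun n hn => ?_⟩
    obtain ⟨p, hp⟩ := h₁ n (le_trans (le_max_left _ _) hn)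
    obtain ⟨q, hq⟩ := h₂ n (le_trans (le_max_right _ _) hn)
    exact ⟨p + q, by rw [add_mul, hp, hq, map_add]⟩
  · intro c d hc
    obtain ⟨N, k, hNk⟩ := H.exists_pow c hc
    refine ⟨N, fun n hn => ⟨Polynomial.C d * X ^ (k + (n - N)), ?_⟩⟩
    rw [map_mul, polynomialHom_X_pow, polynomialHom_C, MonoidAlgebra.single_mul_single,
      MonoidAlgebra.single_mul_single, one_mul, pow_add, ← hNk, mul_assoc, ← pow_add,
      Nat.add_sub_cancel' hn]

end IsCyclicTransversal

end Degrees

/-! ### Right ideals generated by homogeneous elements, and their torsion-freeness over D[z]. -/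

section RightSpan

variable {D : Type*} [DivisionRing D] {M : Type*} [Monoid M] {A : Type*} [AddCommGroup A]

/-- The elements of degree `α₀` of the right ideal generated by the `u j`, `j ∈ J`, where `u j`
has degree `α j`. -/
def homogeneousRightSpan {ι : Type*} (h : M →* Multiplicative A) (J : Finset ι)
    (u : ι → MonoidAlgebra D M) (α : ι → A) (α₀ : A) : AddSubgroup (MonoidAlgebra D M) where
  carrier := {x | ∃ r : ι → MonoidAlgebra D M,
    (∀ j ∈ J, r j ∈ homogeneousComponent D h (-α j + α₀)) ∧ x = ∑ j ∈ J, u j * r j}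
  zero_mem' := ⟨0, fun _ _ => zero_mem _, by simp⟩
  add_mem' := by
    rintro _ _ ⟨r, hr, rfl⟩ ⟨r', hr', rfl⟩
    exact ⟨r + r', fun j hj => add_mem (hr j hj) (hr' j hj), by
      simp [mul_add, Finset.sum_add_distrib]⟩
  neg_mem' := by
    rintro _ ⟨r, hr, rfl⟩
    exact ⟨-r, fun j hj => neg_mem (hr j hj), by simp⟩

variable {ι : Type*} {h : M →* Multiplicative A} {J : Finset ι} {u : ι → MonoidAlgebra D M}
  {α : ι → A} {α₁ γ : A}

theorem mul_mem_homogeneousRightSpan {x w : MonoidAlgebra D M}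
    (hx : x ∈ homogeneousRightSpan h J u α α₁) (hw : w ∈ homogeneousComponent D h γ) :
    x * w ∈ homogeneousRightSpan h J u α (α₁ + γ) := by
  obtain ⟨r, hr, rfl⟩ := hx
  refine ⟨fun j => r j * w, fun j hj => ?_, ?_⟩
  · rw [← add_assoc]
    exact SetLike.GradedMul.mul_mem (hr j hj) hw
  · rw [Finset.sum_mul]
    simp only [mul_assoc]

variable {s : A →+ ℝ} {z : M} {e : M → ℤ} {C : Set M} [IsRightCancelMul M]

namespace IsCyclicTransversal

variable (H : IsCyclicTransversal h s z e C)
include H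

/-- Taking the quotient by c passes to the coefficients r j, since their quotients have degree -α j
+ α₁, on which s is nonnegative. -/
theorem rightQuotient_mem_homogeneousRightSpan {c : M} (hc : c ∈ C)
    (hcγ : h c = Multiplicative.ofAdd γ) (hα : ∀ j ∈ J, s (α j) ≤ s α₁) {x : MonoidAlgebra D M}
    (hx : x ∈ homogeneousRightSpan h J u α (α₁ + γ)) :
    rightQuotient c x ∈ homogeneousRightSpan h J u α α₁ := by
  obtain ⟨r, hr, rfl⟩ := hx
  have hr' : ∀ j ∈ J, r j ∈ homogeneousComponent D h (-α j + α₁ + γ) := fun j hj => by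
    rw [add_assoc]
    exact hr j hj
  refine ⟨fun j => rightQuotient c (r j), fun j hj => rightQuotient_mem hcγ (hr' j hj), ?_⟩
  rw [map_sum]
  refine Finset.sum_congr rfl fun j hj => H.rightQuotient_mul hc hcγ ?_ _ (hr' j hj)
  rw [map_add, map_neg]
  linarith [hα j hj]

/-- A monomial of x with largest index, times the leading term of p, cannot be cancelled. -/
theorem mul_polynomialHom_ne_zero {x : MonoidAlgebra D M} (hx : x ≠ 0) {p : D[X]} (hp : p ≠ 0) :
    x * polynomialHom D z p ≠ 0 := by
  intro h0
  have hne : x.coeff.support.Nonempty := by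
    rw [Finsupp.support_nonempty_iff]
    simpa using hx
  obtain ⟨b, hb, hmax⟩ := Finset.exists_max_image _ e hne
  have h1 := coeff_mul_polynomialHom z x p b
  rw [h0, Finset.sum_eq_single p.natDegree] at h1
  · have h2 : x.coeff b * p.leadingCoeff = 0 := by simpa using h1.symm
    rcases mul_eq_zero.1 h2 with h3 | h3
    · exact Finsupp.mem_support_iff.1 hb h3
    · exact hp (leadingCoeff_eq_zero.1 h3)
  · intro k hk hkn
    have hk' := Finset.mem_range.1 hk
    by_cases hz : x.coeff (b * z ^ (p.natDegree - k)) = 0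
    · rw [hz, zero_mul]
    · have := hmax _ (Finsupp.mem_support_iff.2 hz)
      rw [H.index_mul_pow] at this
      omega
  · simp

/-- The elements of degree greater than the `α j` are torsion-free over `D[z]` modulo the right
ideal generated by the `u j`. -/
theorem mem_homogeneousRightSpan_of_mul {α₀ : A} {x : MonoidAlgebra D M}
    (hx : x ∈ homogeneousComponent D h α₀) (hα : ∀ j ∈ J, 0 ≤ s (α j))
    (hlt : ∀ j ∈ J, s (α j) < s α₀) {p : D[X]} (hp : p ≠ 0)
    (hxp : x * polynomialHom D z p ∈ homogeneousRightSpan h J u α α₀) :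
    x ∈ homogeneousRightSpan h J u α α₀ := by
  classical
  rcases J.eq_empty_or_nonempty with rfl | hJ
  · obtain ⟨r, -, hr⟩ := hxp
    by_contra hx0
    refine H.mul_polynomialHom_ne_zero (x := x) (fun h0 => hx0 (h0 ▸ zero_mem _)) hp ?_
    simpa using hr
  obtain ⟨j₁, hj₁, hmax⟩ := Finset.exists_max_image J (fun j => s (α j)) hJ
  obtain ⟨γ, rfl⟩ : ∃ γ, α₀ = α j₁ + γ := ⟨α₀ - α j₁, by abel⟩
  have hγ : 0 < s γ := by
    have := hlt j₁ hj₁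
    rw [map_add] at this
    linarith
  obtain ⟨T, hT, hT0, hxT⟩ := H.exists_eq_sum_rightQuotient (hα j₁ hj₁) hγ.le hx
  suffices hmem : ∀ c ∈ T, rightQuotient c x ∈ homogeneousRightSpan h J u α (α j₁) by
    rw [hxT]
    exact sum_mem fun c hc => mul_mem_homogeneousRightSpan (hmem c hc)
      (single_mem_homogeneousComponent h (hT c hc).2 1)
  by_contra! hcon
  obtain ⟨c₀, hc₀T, hc₀⟩ := hcon
  -- Among the bad c, one of maximal index is taken: each c * z ^ k with k > 0 has larger index, so
  -- its quotient already lies in the span.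
  obtain ⟨c, hc, hcmax⟩ := Finset.exists_max_image
    (T.filter fun c => rightQuotient c x ∉ homogeneousRightSpan h J u α (α j₁)) e
    ⟨c₀, Finset.mem_filter.2 ⟨hc₀T, hc₀⟩⟩
  obtain ⟨hcT, hcx⟩ := Finset.mem_filter.1 hc
  obtain ⟨hcC, hcγ⟩ := hT c hcT
  have hc1 : h c ≠ 1 := by
    rw [hcγ]
    intro h1
    have : γ = 0 := h1
    simp [this] at hγ
  have hdeg : ∀ k, h (c * z ^ k) = Multiplicative.ofAdd γ := fun k => by
    rw [map_mul, H.degree_z_pow, mul_one, hcγ]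
  -- In the quotient of x p(z) by c * z ^ deg p, the leading coefficient of p multiplies the
  -- quotient of x by c. All other terms involve larger indices.
  have hsum : rightQuotient (c * z ^ p.natDegree) (x * polynomialHom D z p) =
      ∑ k ∈ Finset.range (p.natDegree + 1),
        rightQuotient (c * z ^ (p.natDegree - k)) x * MonoidAlgebra.single 1 (p.coeff k) := by
    ext a
    rw [coeff_rightQuotient, ← mul_assoc, coeff_mul_polynomialHom, MonoidAlgebra.coeff_sum,
      Finsupp.finsetSum_apply]
    refine Finset.sum_congr rfl fun k _ => ?_
    rw [MonoidAlgebra.coeff_mul_single_one, coeff_rightQuotient, mul_assoc]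
  have hscalar : ∀ {y : MonoidAlgebra D M} (d : D),
      y ∈ homogeneousRightSpan h J u α (α j₁) →
      y * MonoidAlgebra.single 1 d ∈ homogeneousRightSpan h J u α (α j₁) := fun d hy => by
    simpa using mul_mem_homogeneousRightSpan hy (single_one_mem (h := h) d)
  have htop : rightQuotient (c * z ^ p.natDegree) (x * polynomialHom D z p) ∈
      homogeneousRightSpan h J u α (α j₁) :=
    H.rightQuotient_mem_homogeneousRightSpan (H.mul_pow_mem hcC hc1 _) (hdeg _) hmax hxp
  rw [hsum, Finset.sum_range_succ] at htop
  have hlow : ∑ k ∈ Finset.range p.natDegree,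
      rightQuotient (c * z ^ (p.natDegree - k)) x * MonoidAlgebra.single 1 (p.coeff k) ∈
      homogeneousRightSpan h J u α (α j₁) := by
    refine sum_mem fun k hk => hscalar _ ?_
    have hk' := Finset.mem_range.1 hk
    by_contra hnot
    have hmemT : c * z ^ (p.natDegree - k) ∈ T := by
      by_contra hnT
      rw [hT0 _ (H.mul_pow_mem hcC hc1 _) (hdeg _) hnT] at hnot
      exact hnot (zero_mem _)
    have := hcmax _ (Finset.mem_filter.2 ⟨hmemT, hnot⟩)
    rw [H.index_mul_pow] at this
    omega
  have hlead := (AddSubgroup.add_mem_cancel_left _ hlow).1 htop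
  have hfin := hscalar (p.leadingCoeff)⁻¹ hlead
  rw [mul_assoc, MonoidAlgebra.single_mul_single, coeff_natDegree,
    mul_inv_cancel₀ (leadingCoeff_ne_zero.2 hp)] at hfin
  apply hcx
  simpa [← MonoidAlgebra.one_def] using hfin

end IsCyclicTransversal

end RightSpan

/-! ### Euclidean reduction of relations. -/

section Semifir

open Classical in
/-- The indices of the terms of a relation neither of whose factors vanishes. -/
noncomputable def activeIndices {R ι : Type*} [Zero R] [Fintype ι] (u v : ι → R) : Finset ι :=
  Finset.univ.filter fun i => u i ≠ 0 ∧ v i ≠ 0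

theorem mem_activeIndices {R ι : Type*} [Zero R] [Fintype ι] {u v : ι → R} {i : ι} :
    i ∈ activeIndices u v ↔ u i ≠ 0 ∧ v i ≠ 0 := by
  simp [activeIndices]

open Classical in
/-- One more than the degree of a nonzero polynomial, and zero for the zero polynomial. -/
noncomputable def polynomialSize {R : Type*} [Semiring R] (p : R[X]) : ℕ :=
  if p = 0 then 0 else p.natDegree + 1

theorem polynomialSize_lt {R : Type*} [Semiring R] {p q : R[X]} (h : p.degree < q.degree) :
    polynomialSize p < polynomialSize q := by
  have hq : q ≠ 0 := by
    rintro rfl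
    simp at h
  by_cases hp : p = 0
  · simp [polynomialSize, hp, hq]
  · have := natDegree_lt_natDegree hp h
    simp [polynomialSize, hp, hq, this]

/-- The multiplier stands on the left of q, as it does when a column operation acts on the right
factors of a relation. -/
theorem exists_degree_sub_mul_lt {D : Type*} [DivisionRing D] {p q : D[X]} (hp : p ≠ 0)
    (hq : q ≠ 0) (hpq : q.natDegree ≤ p.natDegree) : ∃ r : D[X], (p - r * q).degree < p.degree := by
  refine ⟨C (p.leadingCoeff * q.leadingCoeff⁻¹) * X ^ (p.natDegree - q.natDegree), ?_⟩
  have hc : p.leadingCoeff * q.leadingCoeff⁻¹ ≠ 0 :=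
    mul_ne_zero (leadingCoeff_ne_zero.2 hp) (inv_ne_zero (leadingCoeff_ne_zero.2 hq))
  refine degree_sub_lt_left ?_ hp ?_
  · rw [degree_mul, degree_C_mul_X_pow _ hc, degree_eq_natDegree hp, degree_eq_natDegree hq]
    norm_cast
    omega
  · rw [leadingCoeff_mul, leadingCoeff_C_mul_X_pow, mul_assoc,
      inv_mul_cancel₀ (leadingCoeff_ne_zero.2 hq), mul_one]

variable {D : Type*} [DivisionRing D] {M : Type*} [Monoid M] [IsRightCancelMul M] {A : Type*}
  [AddCommGroup A] {h : M →* Multiplicative A} {s : A →+ ℝ} {z : M} {e : M → ℤ} {C : Set M}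

namespace IsCyclicTransversal

variable (H : IsCyclicTransversal h s z e C)
include H

/-- A column operation which makes one of the `u i` vanish, when the coefficients in the top degree
have a single nonzero entry. -/
theorem trivializable_of_single {m : ℕ} {α : Fin m → A} {β α₀ : A}
    {u v w : Fin m → MonoidAlgebra D M}
    (IH : ∀ u' v' : Fin m → MonoidAlgebra D M,
      IsHomogeneousRelation (homogeneousComponent D h) u' v' α β →
      (activeIndices u' v').card < (activeIndices u v).card →
      IsHomogeneouslyTrivializable (homogeneousComponent D h) u' v' α)
    (hI : ∀ i ∈ activeIndices u v, 0 ≤ s (α i) ∧ s (α i) ≤ s α₀)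
    (hrel : IsHomogeneousRelation (homogeneousComponent D h) u v α β)
    (hw0 : ∀ i ∉ activeIndices u v, w i = 0)
    (hw : ∀ i, w i ∈ homogeneousComponent D h (-α i + α₀)) (hsum : ∑ i, u i * w i = 0)
    {i : Fin m} (hi : i ∈ activeIndices u v) (hiα : α i = α₀) {p : D[X]} (hp : p ≠ 0)
    (hwi : w i = polynomialHom D z p)
    (hother : ∀ k ∈ activeIndices u v, k ≠ i → α k = α₀ → w k = 0) :
    IsHomogeneouslyTrivializable (homogeneousComponent D h) u v α := by
  classical
  set J := (activeIndices u v).filter fun k => s (α k) < s α₀ with hJ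
  have hiJ : i ∉ J := by simp [hJ, hiα]
  have hJw : ∀ k, k ≠ i → k ∉ J → w k = 0 := by
    intro k hki hkJ
    by_cases hk : k ∈ activeIndices u v
    · refine hother k hk hki (H.eq_of_degree_eq (le_antisymm (hI k hk).2 ?_))
      by_contra! hlt
      exact hkJ (Finset.mem_filter.2 ⟨hk, hlt⟩)
    · exact hw0 k hk
  have hui : u i * polynomialHom D z p = ∑ k ∈ J, u k * -w k := by
    rw [← Finset.sum_subset (Finset.subset_univ (insert i J)), Finset.sum_insert hiJ, hwi] at hsum
    · rw [eq_neg_of_add_eq_zero_left hsum]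
      simp
    · intro k _ hk
      rw [Finset.mem_insert, not_or] at hk
      rw [hJw k hk.1 hk.2, mul_zero]
  -- Torsion-freeness removes p: u i itself is a combination of the u j of smaller degree.
  obtain ⟨r, hr, hur⟩ := H.mem_homogeneousRightSpan_of_mul (J := J) (u := u) (α := α)
    (hiα ▸ hrel.left_mem i) (fun j hj => (hI j (Finset.mem_filter.1 hj).1).1)
    (fun j hj => (Finset.mem_filter.1 hj).2) hp ⟨fun k => -w k, fun k _ => neg_mem (hw k), hui⟩
  have hri : (fun k => if k ∈ J then -r k else 0) i = 0 := if_neg hiJ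
  have hrmem : ∀ j, (fun k => if k ∈ J then -r k else 0) j ∈
      homogeneousComponent D h (-α j + α i) := by
    intro j
    dsimp only
    split_ifs with hj
    · rw [hiα]
      exact neg_mem (hr j hj)
    · exact zero_mem _
  have hzero : u i + ∑ j, u j * (fun k => if k ∈ J then -r k else 0) j = 0 := by
    rw [hur]
    simp [mul_ite, Finset.sum_ite_mem]
  refine isHomogeneouslyTrivializable_of_columnOperation i _ hri hrmem
    (IH _ _ (hrel.columnOperation i _ hri hrmem) (Finset.card_lt_card ?_))
  rw [Finset.ssubset_iff_of_subset]
  · refine ⟨i, hi, fun hi' => (mem_activeIndices.1 hi').1 ?_⟩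
    rw [Function.update_self, hzero]
  · intro k hk
    obtain ⟨hk1, hk2⟩ := mem_activeIndices.1 hk
    by_cases hki : k = i
    · exact hki ▸ hi
    · by_contra hkI
      have hkJ : k ∉ J := fun hkJ => hkI (Finset.mem_filter.1 hkJ).1
      rw [Function.update_of_ne hki] at hk1
      simp only [hkJ, if_false, zero_mul, sub_zero] at hk2
      exact hkI (mem_activeIndices.2 ⟨hk1, hk2⟩)

/-- Euclid's algorithm on the top-degree entries of an auxiliary relation u · w = 0, with the same
operations applied to v. The total `polynomialSize` drops at each step, even when a nonzero constant
becomes 0, until a single polynomial is left. -/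
theorem trivializable_of_polynomial {m : ℕ} {α : Fin m → A} {β α₀ : A} {I : Finset (Fin m)}
    (IH : ∀ u' v' : Fin m → MonoidAlgebra D M,
      IsHomogeneousRelation (homogeneousComponent D h) u' v' α β →
      (activeIndices u' v').card < I.card →
      IsHomogeneouslyTrivializable (homogeneousComponent D h) u' v' α)
    (hI : ∀ i ∈ I, 0 ≤ s (α i) ∧ s (α i) ≤ s α₀) (N : ℕ) :
    ∀ (u v w : Fin m → MonoidAlgebra D M) (p : Fin m → D[X]),
      IsHomogeneousRelation (homogeneousComponent D h) u v α β →
      activeIndices u v = I → (∀ i ∉ I, w i = 0) →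
      (∀ i, w i ∈ homogeneousComponent D h (-α i + α₀)) → ∑ i, u i * w i = 0 →
      (∀ i, p i ≠ 0 → i ∈ I ∧ α i = α₀) → (∀ i ∈ I, α i = α₀ → w i = polynomialHom D z (p i)) →
      (∃ i, p i ≠ 0) → ∑ i, polynomialSize (p i) = N →
      IsHomogeneouslyTrivializable (homogeneousComponent D h) u v α := by
  classical
  induction N using Nat.strong_induction_on with
  | _ N IHN =>
  intro u v w p hrel hact hw0 hw hsum hpI hwp ⟨i₀, hi₀⟩ hN
  by_cases hex : ∃ i j, i ≠ j ∧ p i ≠ 0 ∧ p j ≠ 0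
  · obtain ⟨i, j, hij, hpi, hpj, hdeg⟩ : ∃ i j, i ≠ j ∧ p i ≠ 0 ∧ p j ≠ 0 ∧
        (p j).natDegree ≤ (p i).natDegree := by
      obtain ⟨i, j, hij, hpi, hpj⟩ := hex
      rcases le_total (p j).natDegree (p i).natDegree with hd | hd
      · exact ⟨i, j, hij, hpi, hpj, hd⟩
      · exact ⟨j, i, hij.symm, hpj, hpi, hd⟩
    obtain ⟨q, hq⟩ := exists_degree_sub_mul_lt hpi hpj hdeg
    obtain ⟨hiI, hiα⟩ := hpI i hpi
    obtain ⟨hjI, hjα⟩ := hpI j hpj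
    set r : Fin m → MonoidAlgebra D M := Pi.single i (polynomialHom D z q) with hr
    have hrj : r j = 0 := Pi.single_eq_of_ne hij.symm _
    have hrmem : ∀ k, r k ∈ homogeneousComponent D h (-α k + α j) := by
      intro k
      by_cases hk : k = i
      · subst hk
        rw [hr, Pi.single_eq_same, hiα, hjα, neg_add_cancel]
        exact H.polynomialHom_mem q
      · rw [hr, Pi.single_eq_of_ne hk]
        exact zero_mem _
    refine isHomogeneouslyTrivializable_of_columnOperation j r hrj hrmem ?_
    have hrel' := hrel.columnOperation j r hrj hrmem
    have hsub : activeIndices (Function.update u j (u j + ∑ k, u k * r k))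
        (fun k => v k - r k * v j) ⊆ I := by
      intro k hk
      obtain ⟨hk1, hk2⟩ := mem_activeIndices.1 hk
      by_contra hkI
      have hkj : k ≠ j := fun hkj => hkI (hkj ▸ hjI)
      have hki : k ≠ i := fun hki => hkI (hki ▸ hiI)
      rw [Function.update_of_ne hkj] at hk1
      simp only [hr, Pi.single_eq_of_ne hki, zero_mul, sub_zero] at hk2
      rw [← hact] at hkI
      exact hkI (mem_activeIndices.2 ⟨hk1, hk2⟩)
    -- If a term of the relation has vanished, the outer induction applies; otherwise the division
    -- continues with the same active set.
    rcases (Finset.card_le_card hsub).lt_or_eq with hlt | heq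
    · exact IH _ _ hrel' hlt
    have hact' := Finset.eq_of_subset_of_card_le hsub heq.ge
    refine IHN (∑ k, polynomialSize (Function.update p i (p i - q * p j) k)) ?_ _ _
      (fun k => w k - r k * w j) (Function.update p i (p i - q * p j)) hrel' hact' ?_ ?_ ?_ ?_ ?_
      ⟨j, by rwa [Function.update_of_ne hij.symm]⟩ rfl
    · rw [← hN]
      refine Finset.sum_lt_sum (fun k _ => ?_) ⟨i, Finset.mem_univ _, ?_⟩
      · by_cases hk : k = i
        · subst hk
          rw [Function.update_self]
          exact (polynomialSize_lt hq).le
        · rw [Function.update_of_ne hk]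
      · rw [Function.update_self]
        exact polynomialSize_lt hq
    · intro k hk
      have hki : k ≠ i := fun hki => hk (hki ▸ hiI)
      rw [hw0 k hk, hr, Pi.single_eq_of_ne hki, zero_mul, sub_zero]
    · intro k
      refine sub_mem (hw k) ?_
      simpa [add_assoc] using SetLike.GradedMul.mul_mem (hrmem k) (hw j)
    · rw [sum_columnOperation j r hrj, hsum]
    · intro k hk
      by_cases hki : k = i
      · exact hki ▸ ⟨hiI, hiα⟩
      · rw [Function.update_of_ne hki] at hk
        exact hpI k hk
    · intro k hk hkα
      by_cases hki : k = i
      · subst hki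
        rw [Function.update_self, hr, Pi.single_eq_same, hwp k hk hkα, hwp j hjI hjα, map_sub,
          map_mul]
      · rw [Function.update_of_ne hki, hr, Pi.single_eq_of_ne hki, zero_mul, sub_zero,
          hwp k hk hkα]
  · push Not at hex
    obtain ⟨hi₀I, hi₀α⟩ := hpI i₀ hi₀
    subst hact
    refine H.trivializable_of_single IH hI hrel hw0 hw hsum hi₀I hi₀α hi₀ (hwp i₀ hi₀I hi₀α) ?_
    intro k hk hki hkα
    rw [hwp k hk hkα, hex i₀ k hki.symm hi₀, map_zero]

/-- The monoid ring of a monoid with a cyclic transversal is a homogeneous semifir. -/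
theorem isHomogeneousSemifir [DecidableEq A] (D : Type*) [DivisionRing D] :
    IsHomogeneousSemifir (homogeneousComponent D h) := by
  classical
  intro n _ m _ u v α β hrel
  induction hn : (activeIndices u v).card using Nat.strong_induction_on generalizing u v with
  | _ N IHN =>
  subst hn
  rcases (activeIndices u v).eq_empty_or_nonempty with hI | hI
  · refine IsTrivialRelation.isHomogeneouslyTrivializable fun i => ?_
    have : i ∉ activeIndices u v := by simp [hI]
    rw [mem_activeIndices] at this
    tauto
  obtain ⟨i₀, hi₀, hmax⟩ := Finset.exists_max_image _ (fun i => s (α i)) hI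
  have hpos : ∀ i ∈ activeIndices u v, 0 ≤ s (α i) ∧ s (α i) ≤ s (α i₀) := fun i hi => by
    refine ⟨?_, hmax i hi⟩
    by_contra! hneg
    exact (mem_activeIndices.1 hi).1 (H.eq_zero_of_neg hneg (hrel.left_mem i))
  have hγ : 0 ≤ s (-α i₀ + β) := by
    by_contra! hneg
    exact (mem_activeIndices.1 hi₀).2 (H.eq_zero_of_neg hneg (hrel.right_mem i₀))
  have hv : ∀ i, v i ∈ homogeneousComponent D h ((-α i + α i₀) + (-α i₀ + β)) := fun i => by
    simpa [add_assoc] using hrel.right_mem i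
  -- The quotients of the v i by c have degree -α i + α i₀, which is zero for the terms of top
  -- degree. The choice of c keeps the quotient at i₀ nonzero.
  obtain ⟨c, hc, hcγ, hc0⟩ := H.exists_rightQuotient_ne_zero (ε := -α i₀ + α i₀) (by simp) hγ
    (hv i₀) (mem_activeIndices.1 hi₀).2
  have hpoly : ∀ i, ∃ N : ℕ, α i = α i₀ → ∀ n ≥ N, ∃ p : D[X],
      rightQuotient c (v i) * MonoidAlgebra.single (z ^ n) 1 = polynomialHom D z p := by
    intro i
    by_cases hi : α i = α i₀
    · obtain ⟨N, hN⟩ := H.exists_polynomial (w := rightQuotient c (v i)) (by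
        have := rightQuotient_mem hcγ (hv i)
        rwa [hi, neg_add_cancel] at this)
      exact ⟨N, fun _ => hN⟩
    · exact ⟨0, fun hi' => absurd hi' hi⟩
  choose N hN using hpoly
  have hN' : ∀ i, ∃ p : D[X], (α i = α i₀ → rightQuotient c (v i) *
      MonoidAlgebra.single (z ^ (Finset.univ.sup N)) 1 = polynomialHom D z p) := by
    intro i
    by_cases hi : α i = α i₀
    · obtain ⟨p, hp⟩ := hN i hi _ (Finset.le_sup (Finset.mem_univ i))
      exact ⟨p, fun _ => hp⟩
    · exact ⟨0, fun hi' => absurd hi' hi⟩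
  choose p hp using hN'
  set ζ : MonoidAlgebra D M := MonoidAlgebra.single (z ^ (Finset.univ.sup N)) 1 with hζ
  refine H.trivializable_of_polynomial (α₀ := α i₀) (fun u' v' hrel' hcard =>
      IHN _ hcard u' v' hrel' rfl) hpos _ u v
    (fun i => if i ∈ activeIndices u v then rightQuotient c (v i) * ζ else 0)
    (fun i => if i ∈ activeIndices u v ∧ α i = α i₀ then p i else 0) hrel rfl ?_ ?_ ?_ ?_ ?_ ?_ rfl
  · intro i hi
    simp [hi]
  · intro i
    split_ifs
    · have := SetLike.GradedMul.mul_mem (rightQuotient_mem hcγ (hv i))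
        (single_mem_homogeneousComponent (D := D) h (c := z ^ (Finset.univ.sup N)) (α := 0)
          (by simp [H.degree_z]) 1)
      simpa using this
    · exact zero_mem _
  · have h1 : ∀ i, u i * (if i ∈ activeIndices u v then rightQuotient c (v i) * ζ else 0) =
        rightQuotient c (u i * v i) * ζ := by
      intro i
      split_ifs with hi
      · rw [H.rightQuotient_mul hc hcγ _ (u i) (hv i), mul_assoc]
        rw [map_add, map_neg]
        linarith [(hpos i hi).2]
      · rw [mem_activeIndices, not_and_or, not_not, not_not] at hi
        rcases hi with hi | hi <;> simp [hi]
    rw [Finset.sum_congr rfl fun i _ => h1 i, ← Finset.sum_mul, ← map_sum, hrel.sum_eq_zero,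
      map_zero, zero_mul]
  · intro i hi
    by_contra hcon
    exact hi (if_neg hcon)
  · intro i hi hiα
    rw [if_pos hi, if_pos ⟨hi, hiα⟩, hp i hiα]
  · refine ⟨i₀, ?_⟩
    rw [if_pos ⟨hi₀, rfl⟩]
    intro hp0
    have h0 := hp i₀ rfl
    rw [hp0, map_zero] at h0
    refine H.mul_polynomialHom_ne_zero hc0 (p := X ^ (Finset.univ.sup N)) (by simp) ?_
    rw [polynomialHom_X_pow]
    exact h0

end IsCyclicTransversal

end Semifir

end CyclicTransversal

/-! ### A crossed homomorphism detecting the positions of `z` in elements of `M₁` -/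

namespace CedoG

/-- The affine action of `G` on functions on the lattice, in which `x` acts as a translation and
`y` as a translation followed by the addition of the indicator function of a half-line. -/
def latticeAction : CedoG →* Equiv.Perm (ℤ × ℤ → ℤ) :=
  FreeGroup.lift ![
    { toFun := fun f P => f (P - (1, 0))
      invFun := fun f P => f (P + (1, 0))
      left_inv := fun f => by simp
      right_inv := fun f => by simp },
    { toFun := fun f P => (if P.2 = 1 ∧ P.1 ≤ 0 then 1 else 0) + f (P - (0, 1))
      invFun := fun f P => f (P + (0, 1)) - (if P.2 = 0 ∧ P.1 ≤ 0 then 1 else 0)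
      left_inv := fun f => by
        ext P
        simp
      right_inv := fun f => by
        ext P
        simp [sub_eq_zero] }]

/-- The lattice function of an element of `G`: for a product of the letters `x`, `y`, `z` it counts
the positions of `z` relative to the path in the lattice defined by the word in `x` and `y`. -/
def latticeFun (g : CedoG) : ℤ × ℤ → ℤ := latticeAction g 0

/-- The degree of an element of `G`. -/
def deg (g : CedoG) : ℤ × ℤ := (δ g).toAdd

@[simp] theorem deg_one : deg 1 = 0 := by simp [deg]
@[simp] theorem deg_mul (g k : CedoG) : deg (g * k) = deg g + deg k := by simp [deg]
@[simp] theorem deg_inv (g : CedoG) : deg g⁻¹ = -deg g := by simp [deg]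
@[simp] theorem deg_x : deg x = (1, 0) := by simp [deg, δ_x]
@[simp] theorem deg_y : deg y = (0, 1) := by simp [deg, δ_y]
@[simp] theorem deg_z : deg z = 0 := by simp [z]
@[simp] theorem deg_zpow (k : ℤ) : deg (z ^ k) = 0 := by
  have : δ z = 1 := deg_z
  simp [deg, this]

/-- The linear part of the action is translation by the degree, which makes `latticeFun` a crossed
homomorphism. -/
theorem latticeAction_apply (g : CedoG) : ∀ (f : ℤ × ℤ → ℤ) (P : ℤ × ℤ),
    latticeAction g f P = latticeFun g P + f (P - deg g) := by
  induction g using FreeGroup.induction_on with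
  | C1 => simp [latticeFun]
  | of i => fin_cases i <;> intro f P <;> simp [latticeFun, latticeAction, deg, δ]
  | inv_of i ih =>
    intro f P
    have key : ∀ f, latticeAction (FreeGroup.of i)⁻¹ f P =
        f (P + deg (FreeGroup.of i)) - latticeFun (FreeGroup.of i) (P + deg (FreeGroup.of i)) := by
      intro f
      have h := ih (latticeAction (FreeGroup.of i)⁻¹ f) (P + deg (FreeGroup.of i))
      rw [← Equiv.Perm.mul_apply, ← map_mul, mul_inv_cancel, add_sub_cancel_right] at h
      simp only [map_one, Equiv.Perm.one_apply] at h
      rw [h]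
      ring
    rw [latticeFun, key, key, deg_inv, sub_neg_eq_add, Pi.zero_apply]
    ring
  | mul g k hg hk =>
    intro f P
    have h : latticeFun (g * k) P = latticeFun g P + latticeFun k (P - deg g) := by
      rw [latticeFun, map_mul, Equiv.Perm.mul_apply, hg]
      rfl
    rw [h, map_mul, Equiv.Perm.mul_apply, hg, hk, deg_mul, add_assoc, sub_sub]

theorem latticeFun_mul (g k : CedoG) (P : ℤ × ℤ) :
    latticeFun (g * k) P = latticeFun g P + latticeFun k (P - deg g) := by
  rw [latticeFun, map_mul, Equiv.Perm.mul_apply, latticeAction_apply]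
  rfl

@[simp] theorem latticeFun_one (P : ℤ × ℤ) : latticeFun 1 P = 0 := by simp [latticeFun]

@[simp] theorem latticeFun_x (P : ℤ × ℤ) : latticeFun x P = 0 := by
  simp [latticeFun, latticeAction, x]

theorem latticeFun_y (P : ℤ × ℤ) : latticeFun y P = if P.2 = 1 ∧ P.1 ≤ 0 then 1 else 0 := by
  simp [latticeFun, latticeAction, y]

theorem latticeFun_inv (g : CedoG) (P : ℤ × ℤ) :
    latticeFun g⁻¹ P = -latticeFun g (P + deg g) := by
  have := latticeFun_mul g⁻¹ g P
  rw [inv_mul_cancel, latticeFun_one, deg_inv, sub_neg_eq_add] at this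
  linarith

theorem x_mul_y : x * y = y * x * z := by
  simp only [z]
  group

/-- The half-lines attached to x y and y x differ only in the point (1, 1), and x y = y x z. -/
theorem latticeFun_z (P : ℤ × ℤ) : latticeFun z P = if P = 0 then 1 else 0 := by
  obtain ⟨i, j⟩ := P
  have h := latticeFun_mul (y * x) z ((i, j) + (1, 1))
  rw [← x_mul_y, latticeFun_mul, latticeFun_mul] at h
  simp only [latticeFun_x, latticeFun_y, deg_mul, deg_x, deg_y, Prod.mk_add_mk, Prod.mk_sub_mk] at h
  simp only [Prod.mk_eq_zero]
  have e1 : ((i + 1 - (0 + 1), j + 1 - (1 + 0)) : ℤ × ℤ) = (i, j) := by ext <;> simp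
  rw [e1] at h
  split_ifs at h ⊢ <;> omega

theorem latticeFun_zpow (k : ℤ) (P : ℤ × ℤ) : latticeFun (z ^ k) P = if P = 0 then k else 0 := by
  induction k with
  | zero => simp
  | succ n ih =>
    rw [zpow_add_one, latticeFun_mul, ih, latticeFun_z, deg_zpow, sub_zero]
    split_ifs <;> simp
  | pred n ih =>
    rw [zpow_sub_one, latticeFun_mul, ih, latticeFun_inv, latticeFun_z, deg_zpow, deg_z, sub_zero,
      add_zero]
    split_ifs <;> simp [sub_eq_add_neg]

/-! ### Normal forms and unique factorization in M₁. -/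

theorem x_mem_M₁ : x ∈ M₁ := Submonoid.subset_closure (by simp)
theorem y_mem_M₁ : y ∈ M₁ := Submonoid.subset_closure (by simp)
theorem z_mem_M₁ : z ∈ M₁ := Submonoid.subset_closure (by simp)
theorem z_inv_mem_M₁ : z⁻¹ ∈ M₁ := Submonoid.subset_closure (by simp)
theorem x_mem_M₀ : x ∈ M₀ := Submonoid.subset_closure (by simp)
theorem y_mem_M₀ : y ∈ M₀ := Submonoid.subset_closure (by simp)
theorem z_mem_M₀ : z ∈ M₀ := Submonoid.subset_closure (by simp)

theorem z_zpow_mem_M₁ (k : ℤ) : z ^ k ∈ M₁ := by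
  cases k with
  | ofNat n => simpa using pow_mem z_mem_M₁ n
  | negSucc n =>
    rw [zpow_negSucc, ← inv_pow]
    exact pow_mem z_inv_mem_M₁ _

theorem M₀_le_M₁ : M₀ ≤ M₁ := Submonoid.closure_mono (by
  intro g hg
  simp only [Set.mem_insert_iff, Set.mem_singleton_iff] at hg ⊢
  tauto)

/-- An element of `M₁` is a power of `z` or has a first letter `x` or `y`. -/
theorem exists_first_letter {c : CedoG} (hc : c ∈ M₁) :
    (∃ k : ℤ, c = z ^ k) ∨ ∃ k : ℤ, ∃ l, (l = x ∨ l = y) ∧ ∃ c' ∈ M₁, c = z ^ k * l * c' := by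
  induction hc using Submonoid.closure_induction_left with
  | one => exact Or.inl ⟨0, by simp⟩
  | mul_left g hg c hc ih =>
    have hz : ∀ e : ℤ, (∃ k : ℤ, z ^ e * c = z ^ k) ∨
        ∃ k : ℤ, ∃ l, (l = x ∨ l = y) ∧ ∃ c' ∈ M₁, z ^ e * c = z ^ k * l * c' := by
      intro e
      rcases ih with ⟨k, rfl⟩ | ⟨k, l, hl, c', hc', rfl⟩
      · exact Or.inl ⟨e + k, by rw [zpow_add]⟩
      · exact Or.inr ⟨e + k, l, hl, c', hc', by rw [zpow_add]; group⟩
    rcases hg with rfl | rfl | rfl | rfl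
    · exact Or.inr ⟨0, x, Or.inl rfl, c, hc, by simp⟩
    · exact Or.inr ⟨0, y, Or.inr rfl, c, hc, by simp⟩
    · simpa using hz 1
    · simpa using hz (-1)

theorem exists_first_letter_M₀ {c : CedoG} (hc : c ∈ M₀) :
    (∃ k : ℕ, c = z ^ k) ∨ ∃ k : ℕ, ∃ l, (l = x ∨ l = y) ∧ ∃ c' ∈ M₀, c = z ^ k * l * c' := by
  induction hc using Submonoid.closure_induction_left with
  | one => exact Or.inl ⟨0, by simp⟩
  | mul_left g hg c hc ih =>
    rcases hg with rfl | rfl | rfl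
    · exact Or.inr ⟨0, x, Or.inl rfl, c, hc, by simp⟩
    · exact Or.inr ⟨0, y, Or.inr rfl, c, hc, by simp⟩
    · rcases ih with ⟨k, rfl⟩ | ⟨k, l, hl, c', hc', rfl⟩
      · exact Or.inl ⟨k + 1, by rw [pow_succ']⟩
      · exact Or.inr ⟨k + 1, l, hl, c', hc', by rw [pow_succ']; group⟩

theorem deg_nonneg {c : CedoG} (hc : c ∈ M₁) : 0 ≤ (deg c).1 ∧ 0 ≤ (deg c).2 := by
  induction hc using Submonoid.closure_induction_left with
  | one => simp
  | mul_left g hg c hc ih =>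
    rcases hg with rfl | rfl | rfl | rfl <;> simp <;> omega

/-- The lattice function of an element of `M₁` vanishes below its path and strictly above or to the
right of its endpoint. -/
theorem latticeFun_eq_zero {c : CedoG} (hc : c ∈ M₁) : ∀ P : ℤ × ℤ,
    P.2 < 0 ∨ (P.2 = 0 ∧ P.1 < 0) ∨ (deg c).1 < P.1 ∨ (deg c).2 < P.2 → latticeFun c P = 0 := by
  induction hc using Submonoid.closure_induction_left with
  | one => simp
  | mul_left g hg c hc ih =>
    rintro ⟨i, j⟩ hP
    obtain ⟨h1, h2⟩ := deg_nonneg hc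
    rw [latticeFun_mul]
    rcases hg with rfl | rfl | rfl | rfl
    · rw [latticeFun_x, ih _ (by simp at hP ⊢; omega), add_zero]
    · rw [latticeFun_y, ih _ (by simp at hP ⊢; omega), add_zero, if_neg]
      simp at hP ⊢
      omega
    · rw [latticeFun_z, ih _ (by simpa using hP), add_zero, if_neg]
      simp at hP ⊢
      omega
    · rw [latticeFun_inv, latticeFun_z, ih _ (by simpa using hP), add_zero, if_neg]
      · simp
      · simp at hP ⊢
        omega

theorem latticeFun_letter {l : CedoG} (hl : l = x ∨ l = y) {P : ℤ × ℤ} (hP : P.2 = 0) :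
    latticeFun l P = 0 := by
  rcases hl with rfl | rfl <;> simp [latticeFun_y, hP]

theorem latticeFun_zpow_mul_letter_mul (k : ℤ) {l : CedoG} (hl : l = x ∨ l = y) {c : CedoG}
    (hc : c ∈ M₁) : latticeFun (z ^ k * l * c) 0 = k := by
  rw [latticeFun_mul, latticeFun_mul, latticeFun_zpow, latticeFun_letter hl (by simp),
    latticeFun_eq_zero hc _ (by rcases hl with rfl | rfl <;> simp)]
  simp

/-- The vanishing along the bottom row says that no net power of z precedes the first y, so this y
moves to the front past the letters x by x y = y x z. -/
theorem exists_eq_y_mul {c : CedoG} (hc : c ∈ M₁) (h0 : ∀ i ≥ 0, latticeFun c (i, 0) = 0)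
    (hdeg : 1 ≤ (deg c).2) : ∃ c' ∈ M₁, c = y * c' := by
  obtain ⟨n, hn⟩ : ∃ n : ℕ, (deg c).1 < n := ⟨(deg c).1.toNat + 1, by omega⟩
  induction n generalizing c with
  | zero => have := deg_nonneg hc; omega
  | succ n ih =>
    rcases exists_first_letter hc with ⟨k, rfl⟩ | ⟨k, l, hl, c', hc', rfl⟩
    · simp at hdeg
    have hk : k = 0 := by
      rw [← latticeFun_zpow_mul_letter_mul k hl hc']
      exact h0 0 le_rfl
    subst hk
    simp only [zpow_zero, one_mul] at h0 hdeg hn ⊢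
    rcases hl with rfl | rfl
    · obtain ⟨c'', hc'', rfl⟩ := ih hc' (fun i hi => by
        have := h0 (i + 1) (by omega)
        rw [latticeFun_mul] at this
        simpa using this) (by simpa using hdeg) (by simp at hn; omega)
      exact ⟨x * z * c'', mul_mem (mul_mem x_mem_M₁ z_mem_M₁) hc'', by
        rw [← mul_assoc, x_mul_y]; group⟩
    · exact ⟨c', hc', rfl⟩

/-- Elements of `M₁` are determined by their degrees and lattice functions. -/
theorem eq_of_latticeFun_eq {a b : CedoG} (ha : a ∈ M₁) (hb : b ∈ M₁) (hdeg : deg a = deg b)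
    (hF : ∀ P, latticeFun a P = latticeFun b P) : a = b := by
  obtain ⟨n, hn⟩ : ∃ n : ℕ, (deg a).1 + (deg a).2 < n :=
    ⟨((deg a).1 + (deg a).2).toNat + 1, by omega⟩
  induction n generalizing a b with
  | zero => have := deg_nonneg ha; omega
  | succ n ih =>
    have cancel : ∀ l, (l = x ∨ l = y) → ∀ a' ∈ M₁, ∀ b' ∈ M₁, ∀ k : ℤ,
        a = z ^ k * l * a' → b = z ^ k * l * b' → a = b := by
      rintro l hl a' ha' b' hb' k rfl rfl
      congr 1
      refine ih ha' hb' (by simpa using hdeg) (fun P => ?_) ?_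
      · have := hF (P + deg (z ^ k * l))
        rw [latticeFun_mul, latticeFun_mul _ b'] at this
        simpa using this
      · rcases hl with rfl | rfl <;> simp at hn <;> omega
    -- After removal of z ^ k, the function of an element starting with y vanishes on the bottom row
    -- to the right of 0. Hence an element with the same function can also be rewritten to start
    -- with y.
    have hyx : ∀ a ∈ M₁, ∀ b' ∈ M₁, ∀ k : ℤ, deg a = deg (z ^ k * y * b') →
        (∀ P, latticeFun a P = latticeFun (z ^ k * y * b') P) →
        ∃ a' ∈ M₁, a = z ^ k * y * a' := by
      intro a ha b' hb' k hdeg hF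
      obtain ⟨a', ha', h⟩ := exists_eq_y_mul (c := z ^ (-k) * a) (mul_mem (z_zpow_mem_M₁ _) ha)
        (fun i hi => by
          rw [latticeFun_mul, hF, mul_assoc, latticeFun_mul, latticeFun_mul,
            latticeFun_letter (Or.inr rfl) (by simp), latticeFun_eq_zero hb' _ (by simp)]
          rw [latticeFun_zpow, latticeFun_zpow]
          simp
          split_ifs <;> simp)
        (by
          have := deg_nonneg hb'
          simp [hdeg]
          omega)
      exact ⟨a', ha', by rw [mul_assoc, ← h]; group⟩
    rcases exists_first_letter ha with ⟨k, rfl⟩ | ⟨k, l, hl, a', ha', rfl⟩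
    · rcases exists_first_letter hb with ⟨k', rfl⟩ | ⟨k', l', hl', b', hb', rfl⟩
      · have := hF 0
        rw [latticeFun_zpow, latticeFun_zpow] at this
        simp at this
        rw [this]
      · exfalso
        have := deg_nonneg hb'
        have h1 := congrArg Prod.fst hdeg
        have h2 := congrArg Prod.snd hdeg
        rcases hl' with rfl | rfl <;> simp at h1 h2 <;> omega
    · rcases exists_first_letter hb with ⟨k', rfl⟩ | ⟨k', l', hl', b', hb', rfl⟩
      · exfalso
        have := deg_nonneg ha'
        have h1 := congrArg Prod.fst hdeg
        have h2 := congrArg Prod.snd hdeg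
        rcases hl with rfl | rfl <;> simp at h1 h2 <;> omega
      · have hk := hF 0
        rw [latticeFun_zpow_mul_letter_mul k hl ha',
          latticeFun_zpow_mul_letter_mul k' hl' hb'] at hk
        subst hk
        rcases hl with rfl | rfl
        · rcases hl' with rfl | rfl
          · exact cancel x (Or.inl rfl) _ ha' _ hb' k rfl rfl
          · obtain ⟨a'', ha'', h⟩ := hyx _ ha _ hb' k hdeg hF
            exact cancel y (Or.inr rfl) _ ha'' _ hb' k h rfl
        · rcases hl' with rfl | rfl
          · obtain ⟨b'', hb'', h⟩ := hyx _ hb _ ha' k hdeg.symm fun P => (hF P).symm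
            exact cancel y (Or.inr rfl) _ ha' _ hb'' k rfl h
          · exact cancel y (Or.inr rfl) _ ha' _ hb' k rfl rfl

/-- Factorizations in `M₁` with left factors of a given degree are unique up to powers of `z`. -/
theorem exists_zpow_of_mul_eq {a a' c c' : CedoG} (ha : a ∈ M₁) (ha' : a' ∈ M₁) (hc : c ∈ M₁)
    (hc' : c' ∈ M₁) (hdeg : deg a = deg a') (h : a * c = a' * c') : ∃ k : ℤ, a' = a * z ^ k := by
  refine ⟨latticeFun a' (deg a) - latticeFun a (deg a), ?_⟩
  refine eq_of_latticeFun_eq ha' (mul_mem ha (z_zpow_mem_M₁ _)) (by simp [hdeg]) fun P => ?_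
  rw [latticeFun_mul, latticeFun_zpow]
  split_ifs with hP
  · rw [sub_eq_zero.1 hP]
    ring
  rw [add_zero]
  -- Away from deg a, either both left factors contribute 0 at P or both right factors do. So the
  -- left factors agree except at deg a, where a power of z corrects the difference.
  have key := congrArg (fun g => latticeFun g P) h
  simp only [latticeFun_mul, ← hdeg] at key
  by_cases h1 : (deg a).1 < P.1 ∨ (deg a).2 < P.2
  · rw [latticeFun_eq_zero ha _ (Or.inr (Or.inr h1)),
      latticeFun_eq_zero ha' _ (Or.inr (Or.inr (hdeg ▸ h1)))]
  · have h2 : (P - deg a).2 < 0 ∨ ((P - deg a).2 = 0 ∧ (P - deg a).1 < 0) ∨ False := by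
      simp only [Prod.fst_sub, Prod.snd_sub]
      by_contra hcon
      refine hP (Prod.ext ?_ ?_) <;> simp <;> omega
    have h3 : ∀ d ∈ M₁, latticeFun d (P - deg a) = 0 := fun d hd =>
      latticeFun_eq_zero hd _ (by tauto)
    rw [h3 c hc, h3 c' hc'] at key
    linarith

end CedoG

/-! ### Splitting elements of the limit monoids at a given degree -/

namespace CedoG

open Real goldenRatio

/-- The expanding linear form on degrees. -/
noncomputable def slope : ℤ × ℤ →+ ℝ where
  toFun P := P.1 + P.2 * φ
  map_zero' := by simp
  map_add' P Q := by push_cast [Prod.fst_add, Prod.snd_add]; ring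

/-- The contracting linear form on degrees. -/
noncomputable def coslope : ℤ × ℤ →+ ℝ where
  toFun P := P.1 * φ - P.2
  map_zero' := by simp
  map_add' P Q := by push_cast [Prod.fst_add, Prod.snd_add]; ring

theorem slope_apply (P : ℤ × ℤ) : slope P = P.1 + P.2 * φ := rfl

theorem coslope_apply (P : ℤ × ℤ) : coslope P = P.1 * φ - P.2 := rfl

theorem slope_injective : Function.Injective slope := by
  rw [injective_iff_map_eq_zero]
  rintro ⟨p, q⟩ h
  rw [slope_apply] at h
  have hq : q = 0 := by
    by_contra hq
    refine goldenRatio_irrational ⟨-p / q, ?_⟩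
    have : (q : ℝ) ≠ 0 := by exact_mod_cast hq
    push_cast
    rw [div_eq_iff this]
    change (p : ℝ) + q * φ = 0 at h
    linarith
  subst hq
  simpa using h

theorem deg_σ (g : CedoG) : deg (σ g) = ((deg g).1 + (deg g).2, (deg g).1 + 2 * (deg g).2) := by
  have h : (δ.comp σ.toMonoidHom) = (AddMonoidHom.toMultiplicative
      { toFun := fun P : ℤ × ℤ => (P.1 + P.2, P.1 + 2 * P.2)
        map_zero' := by simp
        map_add' := fun P Q => by ext <;> simp <;> ring }).comp δ := by
    ext i
    · fin_cases i
      · change (δ (σ x)).toAdd.1 = _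
        simp [σ_x, δ_x, δ_y]
        rfl
      · change (δ (σ y)).toAdd.1 = _
        simp [σ_y, δ_x, δ_y]
        rfl
    · fin_cases i
      · change (δ (σ x)).toAdd.2 = _
        simp [σ_x, δ_x, δ_y]
        rfl
      · change (δ (σ y)).toAdd.2 = _
        simp [σ_y, δ_x, δ_y]
        rfl
  exact congrArg Multiplicative.toAdd (DFunLike.congr_fun h g)

/-- `slope` and `coslope` are eigenforms of the action of σ on degrees, with eigenvalues φ² and 2 −
φ = φ⁻². -/
theorem slope_deg_σ (g : CedoG) : slope (deg (σ g)) = φ ^ 2 * slope (deg g) := by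
  rw [deg_σ, slope_apply, slope_apply, goldenRatio_sq]
  push_cast
  linear_combination (-(deg g).2 : ℝ) * goldenRatio_sq

theorem coslope_deg_σ (g : CedoG) : coslope (deg (σ g)) = (2 - φ) * coslope (deg g) := by
  rw [deg_σ, coslope_apply, coslope_apply]
  push_cast
  linear_combination ((deg g).1 : ℝ) * goldenRatio_sq

theorem slope_deg_σ_pow (n : ℕ) (g : CedoG) :
    slope (deg ((σ ^ n) g)) = (φ ^ 2) ^ n * slope (deg g) := by
  induction n with
  | zero => simp
  | succ n ih => rw [pow_succ', MulAut.mul_apply, slope_deg_σ, ih]; ring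

theorem coslope_deg_σ_pow (n : ℕ) (g : CedoG) :
    coslope (deg ((σ ^ n) g)) = (2 - φ) ^ n * coslope (deg g) := by
  induction n with
  | zero => simp
  | succ n ih => rw [pow_succ', MulAut.mul_apply, coslope_deg_σ, ih]; ring

theorem deg_σ_pow_eq_iff (n : ℕ) {g k : CedoG} :
    deg ((σ ^ n) g) = deg ((σ ^ n) k) ↔ deg g = deg k := by
  have : (φ ^ 2) ^ n ≠ 0 := pow_ne_zero _ (pow_ne_zero _ goldenRatio_ne_zero)
  rw [← slope_injective.eq_iff, slope_deg_σ_pow, slope_deg_σ_pow, mul_right_inj' this,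
    slope_injective.eq_iff]

/-! ### Prefixes of the iterated substitution stay in a thin strip. -/

/-- The letters `x` (for `true`) and `y` (for `false`). -/
def letter (b : Bool) : CedoG := cond b x y

/-- The product of a word in `x` and `y`. -/
def wordProd (w : List Bool) : CedoG := (w.map letter).prod

/-- The substitution on words in `x` and `y` induced by `σ`. -/
def substitution (w : List Bool) : List Bool :=
  w.flatMap fun b => cond b [false, true] [false, true, false]

@[simp] theorem wordProd_nil : wordProd [] = 1 := rfl

@[simp] theorem wordProd_cons (b : Bool) (w : List Bool) :
    wordProd (b :: w) = letter b * wordProd w := by simp [wordProd]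

theorem wordProd_append (w w' : List Bool) : wordProd (w ++ w') = wordProd w * wordProd w' := by
  simp [wordProd]

theorem wordProd_substitution (w : List Bool) : wordProd (substitution w) = σ (wordProd w) := by
  induction w with
  | nil => simp [substitution]
  | cons b w ih =>
    rw [substitution, List.flatMap_cons, wordProd_append, wordProd_cons, map_mul, ← ih]
    cases b <;> simp [letter, σ_x, σ_y, mul_assoc, substitution]

theorem wordProd_substitution_iterate (n : ℕ) (w : List Bool) :
    wordProd (substitution^[n] w) = (σ ^ n) (wordProd w) := by
  induction n with
  | zero => simp
  | succ n ih =>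
    rw [Function.iterate_succ_apply', wordProd_substitution, ih, pow_succ', MulAut.mul_apply]

theorem wordProd_mem {N : Submonoid CedoG} (hx : x ∈ N) (hy : y ∈ N) (w : List Bool) :
    wordProd w ∈ N := by
  induction w with
  | nil => exact one_mem _
  | cons b w ih =>
    rw [wordProd_cons]
    refine mul_mem ?_ ih
    cases b
    exacts [hy, hx]

theorem deg_wordProd (w : List Bool) : (deg (wordProd w)).1 + (deg (wordProd w)).2 = w.length := by
  induction w with
  | nil => simp
  | cons b w ih => cases b <;> simp [letter] <;> omega

/-- The factor 2 − φ maps (−φ, 1) onto (1 − φ, 2 − φ). The new intermediate points inside the image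
of a letter are shifted by −1 (after y) or φ − 1 (after y x), which gives (−φ, 1 − φ) and (0, 1):
all still inside (−φ, 1). The offset θ lets the induction start at any point of the path. -/
theorem coslope_substitution_prefix (w : List Bool) : ∀ θ : ℝ,
    (∀ p, p <+: w → θ + coslope (deg (wordProd p)) ∈ Set.Ioo (-φ) 1) →
    ∀ p, p <+: substitution w →
      (2 - φ) * θ + coslope (deg (wordProd p)) ∈ Set.Ioo (-φ) 1 := by
  have hφ := goldenRatio_sq
  have hφ1 := one_lt_goldenRatio
  have hφ2 := goldenRatio_lt_two
  have bound : ∀ θ ∈ Set.Ioo (-φ) 1, 1 - φ < (2 - φ) * θ ∧ (2 - φ) * θ < 2 - φ := by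
    rintro θ ⟨h1, h2⟩
    constructor <;> nlinarith
  induction w with
  | nil =>
    intro θ h p hp
    have h0 := bound θ (by simpa using h [] (List.prefix_refl _))
    simp only [substitution, List.flatMap_nil, List.prefix_nil] at hp
    subst hp
    simp only [wordProd_nil, deg_one, map_zero, add_zero, Set.mem_Ioo]
    constructor <;> linarith
  | cons b w ih =>
    intro θ h p hp
    have h0 := bound θ (by simpa using h [] (List.nil_prefix))
    have htail := ih (θ + coslope (deg (letter b))) (fun q hq => by
      have := h (b :: q) (List.cons_prefix_cons.2 ⟨rfl, hq⟩)
      rwa [wordProd_cons, deg_mul, map_add, ← add_assoc] at this)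
    have key : ∀ q, q <+: substitution w → (2 - φ) * θ + coslope (deg (σ (letter b))) +
        coslope (deg (wordProd q)) ∈ Set.Ioo (-φ) 1 := by
      intro q hq
      rw [coslope_deg_σ, ← mul_add]
      exact htail q hq
    have e0 : coslope (deg 1) = 0 := by simp
    have e1 : coslope (deg y) = -1 := by simp [coslope_apply]
    have e2 : coslope (deg (y * x)) = φ - 1 := by simp [coslope_apply]
    cases b
    · have hsub : substitution (false :: w) = false :: true :: false :: substitution w := rfl
      rw [hsub, List.prefix_cons_iff] at hp
      rcases hp with rfl | ⟨p, rfl, hp⟩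
      · rw [wordProd_nil, e0]
        constructor <;> linarith
      rw [List.prefix_cons_iff] at hp
      rcases hp with rfl | ⟨p, rfl, hp⟩
      · simp only [wordProd_cons, wordProd_nil, mul_one, letter, cond_false, e1]
        constructor <;> linarith
      rw [List.prefix_cons_iff] at hp
      rcases hp with rfl | ⟨p, rfl, hp⟩
      · simp only [wordProd_cons, wordProd_nil, mul_one, letter, cond_false, cond_true, e2]
        constructor <;> linarith
      · have := key p hp
        rw [add_assoc, ← map_add, ← deg_mul] at this
        simpa [letter, σ_y, mul_assoc] using this
    · have hsub : substitution (true :: w) = false :: true :: substitution w := rfl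
      rw [hsub, List.prefix_cons_iff] at hp
      rcases hp with rfl | ⟨p, rfl, hp⟩
      · rw [wordProd_nil, e0]
        constructor <;> linarith
      rw [List.prefix_cons_iff] at hp
      rcases hp with rfl | ⟨p, rfl, hp⟩
      · simp only [wordProd_cons, wordProd_nil, mul_one, letter, cond_false, e1]
        constructor <;> linarith
      · have := key p hp
        rw [add_assoc, ← map_add, ← deg_mul] at this
        simpa [letter, σ_x, mul_assoc] using this

/-- At least one substitution is needed, since the letter x alone ends at coslope φ > 1. -/
theorem coslope_prefix (n : ℕ) (b : Bool) : ∀ p, p <+: substitution^[n + 1] [b] →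
    coslope (deg (wordProd p)) ∈ Set.Ioo (-φ) 1 := by
  have hφ1 := one_lt_goldenRatio
  have hφ2 := goldenRatio_lt_two
  induction n with
  | zero =>
    intro p hp
    have hp' : p ∈ List.inits (cond b [false, true] [false, true, false]) := by
      rw [List.mem_inits]
      simpa [substitution] using hp
    have hval : coslope (deg (wordProd p)) = 0 ∨ coslope (deg (wordProd p)) = -1 ∨
        coslope (deg (wordProd p)) = φ - 1 ∨ coslope (deg (wordProd p)) = φ - 2 := by
      cases b <;> simp only [cond_false, cond_true, List.inits, List.map_cons, List.map_nil,
        List.mem_cons, List.not_mem_nil, or_false] at hp'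
      · rcases hp' with rfl | rfl | rfl | rfl <;> norm_num [letter, coslope_apply]
      · rcases hp' with rfl | rfl | rfl <;> norm_num [letter, coslope_apply]
    rcases hval with h | h | h | h <;> rw [h] <;> constructor <;> linarith
  | succ n ih =>
    intro p hp
    rw [Function.iterate_succ_apply'] at hp
    simpa using coslope_substitution_prefix _ 0 (by simpa using ih) p hp

/-- The sum of the coordinates in terms of the two linear forms. -/
theorem length_eq (P : ℤ × ℤ) : (1 + φ ^ 2) * (P.1 + P.2) =
    (1 + φ) * slope P + (φ - 1) * coslope P := by
  rw [slope_apply, coslope_apply]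
  ring

/-- Every degree between those of `1` and a letter is attained by a prefix of an iterated image of
the letter. -/
theorem exists_split_letter (b : Bool) (g : CedoG) (h0 : 0 ≤ slope (deg g))
    (h1 : slope (deg g) ≤ slope (deg (letter b))) :
    ∃ n : ℕ, ∃ w w' : List Bool, (σ ^ n) (letter b) = wordProd w * wordProd w' ∧
      deg (wordProd w) = deg ((σ ^ n) g) := by
  rcases h0.eq_or_lt with h0 | h0
  · refine ⟨0, [], [b], by simp, ?_⟩
    rw [← map_zero slope] at h0
    simpa using slope_injective h0
  rcases h1.eq_or_lt with h1 | h1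
  · exact ⟨0, [b], [], by simp, by simpa using (slope_injective h1).symm⟩
  have hφ := goldenRatio_sq
  have hφ1 := one_lt_goldenRatio
  have hφ2 := goldenRatio_lt_two
  have hexp : Filter.Tendsto (fun n : ℕ => (φ ^ 2) ^ n) Filter.atTop Filter.atTop :=
    tendsto_pow_atTop_atTop_of_one_lt (by nlinarith)
  have hcon : Filter.Tendsto (fun n : ℕ => (2 - φ) ^ n) Filter.atTop (nhds 0) :=
    tendsto_pow_atTop_nhds_zero_of_lt_one (by linarith) (by linarith)
  have hsmall : ∀ g : CedoG, ∀ᶠ n in Filter.atTop, |coslope (deg ((σ ^ n) g))| < 1 := by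
    intro g
    have h := (hcon.mul_const (coslope (deg g))).abs
    simp only [zero_mul, abs_zero] at h
    filter_upwards [h.eventually_lt_const one_pos] with n hn
    rwa [coslope_deg_σ_pow]
  have hlarge : ∀ g : CedoG, 0 < slope (deg g) →
      ∀ᶠ n in Filter.atTop, 1 ≤ slope (deg ((σ ^ n) g)) := by
    intro g hg
    filter_upwards [(hexp.atTop_mul_const hg).eventually_ge_atTop 1] with n hn
    rwa [slope_deg_σ_pow]
  have hpos : ∀ g : CedoG, 0 < slope (deg g) →
      ∀ᶠ n in Filter.atTop, 0 ≤ (deg ((σ ^ n) g)).1 + (deg ((σ ^ n) g)).2 := by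
    intro g hg
    filter_upwards [hsmall g, hlarge g hg] with n hn1 hn2
    have h := length_eq (deg ((σ ^ n) g))
    have h3 := (abs_lt.1 hn1).1
    have h4 : 0 ≤ (1 + φ) * slope (deg ((σ ^ n) g)) + (φ - 1) * coslope (deg ((σ ^ n) g)) := by
      nlinarith
    rw [← h] at h4
    have h5 := nonneg_of_mul_nonneg_right h4 (by positivity)
    exact_mod_cast h5
  -- For this n the target has coslope in (−1, 1), and its coordinate sum L lies between 0 and the
  -- length of the word. The prefix of length L is the only candidate.
  obtain ⟨n, hn1, hn2, hn3, hn4⟩ := ((hsmall g).and ((hpos g h0).and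
    ((hpos (g⁻¹ * letter b) (by simp; linarith)).and (Filter.eventually_ge_atTop 1)))).exists
  set k := (σ ^ n) g with hk
  set W := substitution^[n] [b] with hW
  have hWprod : wordProd W = (σ ^ n) (letter b) := by
    rw [hW, wordProd_substitution_iterate]
    simp
  set L := ((deg k).1 + (deg k).2).toNat with hL
  have hLW : L ≤ W.length := by
    have := deg_wordProd W
    rw [map_mul, map_inv, ← hWprod, ← hk, deg_mul, deg_inv] at hn3
    simp only [Prod.fst_add, Prod.snd_add, Prod.fst_neg, Prod.snd_neg] at hn3
    omega
  refine ⟨n, W.take L, W.drop L, ?_, ?_⟩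
  · rw [← wordProd_append, List.take_append_drop, hWprod]
  obtain ⟨n, rfl⟩ : ∃ m, n = m + 1 := ⟨n - 1, by omega⟩
  obtain ⟨hlo, hhi⟩ := coslope_prefix n b _ (List.take_prefix L W)
  have hlen := deg_wordProd (W.take L)
  rw [List.length_take, min_eq_left hLW, hL, Int.toNat_of_nonneg hn2] at hlen
  obtain ⟨hlo', hhi'⟩ := abs_lt.1 hn1
  set P := deg (wordProd (W.take L))
  set Q := deg k
  have hdiff : coslope P - coslope Q = ((P.1 - Q.1 : ℤ) : ℝ) * (φ + 1) := by
    have : (P.1 : ℝ) + P.2 = Q.1 + Q.2 := by exact_mod_cast hlen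
    rw [coslope_apply, coslope_apply]
    push_cast
    linear_combination -this
  -- The difference of coslopes is an integer multiple of φ + 1 and lies in (−φ − 1, 2), where 2 < φ
  -- + 1.
  have hP1 : P.1 - Q.1 = 0 := by
    have hup : ((P.1 - Q.1 : ℤ) : ℝ) < 1 := by nlinarith
    have hdown : (-1 : ℝ) < ((P.1 - Q.1 : ℤ) : ℝ) := by nlinarith
    have : P.1 - Q.1 < 1 := by exact_mod_cast hup
    have : -1 < P.1 - Q.1 := by exact_mod_cast hdown
    omega
  ext <;> omega

end CedoG

/-! ### The cyclic transversal of the limit monoids -/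

namespace CedoG

/-- Generators are passed one by one while the target lies beyond them. One that overshoots has
positive slope, so it is x or y and is split by `exists_split_letter`. -/
theorem exists_split_closure {S : Set CedoG} {N : Submonoid CedoG} (hNS : N = Submonoid.closure S)
    (hN : ∀ a ∈ N, σ a ∈ N) (hx : x ∈ N) (hy : y ∈ N) (hS : ∀ l ∈ S, l = x ∨ l = y ∨ deg l = 0)
    {c : CedoG} (hc : c ∈ N) : ∀ g : CedoG, 0 ≤ slope (deg g) → slope (deg g) ≤ slope (deg c) →
      ∃ n : ℕ, ∃ a ∈ N, ∃ b ∈ N, (σ ^ n) c = a * b ∧ deg a = deg ((σ ^ n) g) := by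
  have hpow : ∀ (n : ℕ), ∀ a ∈ N, (σ ^ n) a ∈ N := fun n a ha =>
    σ_pow_mem hN (Nat.zero_le n) (by simpa using ha)
  rw [hNS] at hc
  induction hc using Submonoid.closure_induction_left with
  | one =>
    intro g h0 h1
    refine ⟨0, 1, one_mem _, 1, one_mem _, by simp, ?_⟩
    have : slope (deg g) = slope 0 := by
      rw [map_zero]
      exact le_antisymm (by simpa using h1) h0
    simpa using (slope_injective this).symm
  | mul_left l hl c hc ih =>
    rw [← hNS] at hc
    have hlN : l ∈ N := hNS ▸ Submonoid.subset_closure hl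
    intro g h0 h1
    rw [deg_mul, map_add] at h1
    have hstep : slope (deg l) ≤ slope (deg g) →
        ∃ n : ℕ, ∃ a ∈ N, ∃ b ∈ N, (σ ^ n) (l * c) = a * b ∧ deg a = deg ((σ ^ n) g) := by
      intro hlg
      obtain ⟨n, a, ha, b, hb, hab, hdeg⟩ := ih (l⁻¹ * g) (by simpa using hlg)
        (by simp only [deg_mul, deg_inv, map_add, map_neg]; linarith)
      refine ⟨n, (σ ^ n) l * a, mul_mem (hpow n l hlN) ha, b, hb, ?_, ?_⟩
      · rw [map_mul, hab, mul_assoc]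
      · rw [deg_mul, hdeg, ← deg_mul, ← map_mul, mul_inv_cancel_left]
    rcases le_or_gt (slope (deg l)) (slope (deg g)) with hle | hlt
    · exact hstep hle
    have hletter : ∃ b, l = letter b := by
      rcases hS l hl with rfl | rfl | h
      · exact ⟨true, rfl⟩
      · exact ⟨false, rfl⟩
      · rw [h, map_zero] at hlt
        linarith
    obtain ⟨b, rfl⟩ := hletter
    obtain ⟨n, w, w', hw, hdeg⟩ := exists_split_letter b g h0 hlt.le
    exact ⟨n, wordProd w, wordProd_mem hx hy w, wordProd w' * (σ ^ n) c,
      mul_mem (wordProd_mem hx hy w') (hpow n c hc), by rw [map_mul, hw, mul_assoc], hdeg⟩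

/-! ### The leading exponent of z and its invariance under σ. -/

theorem σ_pow_z_zpow (n : ℕ) (k : ℤ) : (σ ^ n) (z ^ k) = z ^ k := by
  induction n with
  | zero => simp
  | succ n ih => rw [pow_succ', MulAut.mul_apply, ih, map_zpow, σ_z]

/-- σ fixes z and sends both letters to words starting with y, so the leading power of z is
unchanged. -/
theorem latticeFun_σ_zero {c : CedoG} (hc : c ∈ M₁) : latticeFun (σ c) 0 = latticeFun c 0 := by
  rcases exists_first_letter hc with ⟨k, rfl⟩ | ⟨k, l, hl, c', hc', rfl⟩
  · rw [map_zpow, σ_z]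
  · have hσ := σ_mem_M₁ hc'
    rw [latticeFun_zpow_mul_letter_mul k hl hc', map_mul, map_mul, map_zpow, σ_z]
    rcases hl with rfl | rfl
    · rw [σ_x, ← mul_assoc, mul_assoc (z ^ k * y),
        latticeFun_zpow_mul_letter_mul k (Or.inr rfl) (mul_mem x_mem_M₁ hσ)]
    · rw [σ_y, mul_assoc y, ← mul_assoc, mul_assoc (z ^ k * y),
        latticeFun_zpow_mul_letter_mul k (Or.inr rfl)
          (mul_mem (mul_mem x_mem_M₁ y_mem_M₁) hσ)]

open Classical in
/-- The exponent of `z` at the beginning of an element of the limit monoid. -/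
noncomputable def startIndex (c : CedoG) : ℤ :=
  if h : ∃ n : ℕ, (σ ^ n) c ∈ M₁ then latticeFun ((σ ^ Nat.find h) c) 0 else 0

theorem latticeFun_σ_pow_zero {c : CedoG} {m n : ℕ} (hmn : m ≤ n) (hc : (σ ^ m) c ∈ M₁) :
    latticeFun ((σ ^ n) c) 0 = latticeFun ((σ ^ m) c) 0 := by
  induction n, hmn using Nat.le_induction with
  | base => rfl
  | succ n hmn ih =>
    rw [pow_succ', MulAut.mul_apply, latticeFun_σ_zero (σ_pow_mem (fun _ => σ_mem_M₁) hmn hc), ih]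

theorem startIndex_eq {c : CedoG} {n : ℕ} (hc : (σ ^ n) c ∈ M₁) :
    startIndex c = latticeFun ((σ ^ n) c) 0 := by
  classical
  have h : ∃ n : ℕ, (σ ^ n) c ∈ M₁ := ⟨n, hc⟩
  rw [startIndex, dif_pos h, latticeFun_σ_pow_zero (Nat.find_min' h hc) (Nat.find_spec h)]

theorem startIndex_zpow_mul {c : CedoG} {n : ℕ} (hc : (σ ^ n) c ∈ M₁) (k : ℤ) :
    startIndex (z ^ k * c) = k + startIndex c := by
  have h : (σ ^ n) (z ^ k * c) = z ^ k * (σ ^ n) c := by rw [map_mul, σ_pow_z_zpow]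
  rw [startIndex_eq hc, startIndex_eq (h ▸ mul_mem (z_zpow_mem_M₁ k) hc), h, latticeFun_mul,
    latticeFun_zpow]
  simp

theorem startIndex_mul_zpow {c : CedoG} {n : ℕ} (hc : (σ ^ n) c ∈ M₁) (hdeg : deg c ≠ 0) (k : ℤ) :
    startIndex (c * z ^ k) = startIndex c := by
  have h : (σ ^ n) (c * z ^ k) = (σ ^ n) c * z ^ k := by rw [map_mul, σ_pow_z_zpow]
  have hdeg' : deg ((σ ^ n) c) ≠ 0 := by
    rw [← deg_one, ← map_one (σ ^ n), Ne, deg_σ_pow_eq_iff, deg_one]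
    exact hdeg
  rw [startIndex_eq hc, startIndex_eq (h ▸ mul_mem hc (z_zpow_mem_M₁ k)), h, latticeFun_mul,
    latticeFun_zpow, if_neg (by simpa using hdeg'), add_zero]

theorem exists_deg_eq (P : ℤ × ℤ) : ∃ g : CedoG, deg g = P := by
  refine ⟨x ^ P.1 * y ^ P.2, ?_⟩
  have h : ∀ (g : CedoG) (k : ℤ), deg (g ^ k) = k • deg g := fun g k => by simp [deg]
  rw [deg_mul, h, h, deg_x, deg_y]
  ext <;> simp

theorem slope_deg_nonneg {c : CedoG} (hc : c ∈ M₁) : 0 ≤ slope (deg c) := by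
  obtain ⟨h1, h2⟩ := deg_nonneg hc
  rw [slope_apply]
  have := Real.goldenRatio_pos
  positivity

theorem eq_zpow_of_deg_eq_zero {c : CedoG} (hc : c ∈ M₁) (hdeg : deg c = 0) :
    ∃ k : ℤ, c = z ^ k := by
  obtain ⟨k, hk⟩ := exists_zpow_of_mul_eq (one_mem M₁) hc hc (one_mem M₁) (by simp [hdeg])
    (by simp : 1 * c = c * 1)
  exact ⟨k, by simpa using hk⟩

/-- A right factor is normalized by moving its leading power of z to the left factor; `hstart` keeps
both factors in the monoid. The index is the value of the lattice function at the endpoint, where an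
appended z is counted. -/
theorem isCyclicTransversal {S : Set CedoG} {N : Submonoid CedoG} (hNS : N = Submonoid.closure S)
    (hN : ∀ a ∈ N, σ a ∈ N) (hx : x ∈ N) (hy : y ∈ N) (hz : z ∈ limitSubmonoid N hN)
    (hS : ∀ l ∈ S, l = x ∨ l = y ∨ deg l = 0) (hNM : N ≤ M₁)
    (hstart : ∀ c ∈ N, z ^ latticeFun c 0 ∈ N ∧ z ^ (-latticeFun c 0) * c ∈ N) :
    IsCyclicTransversal (δ.comp (limitSubmonoid N hN).subtype) slope ⟨z, hz⟩
      (fun c => latticeFun c.1 (deg c.1)) {c | startIndex c.1 = 0} where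
  degree_injective := slope_injective
  nonneg := by
    rintro ⟨c, n, hc⟩
    have h := slope_deg_nonneg (hNM hc)
    rw [slope_deg_σ_pow] at h
    have := Real.goldenRatio_pos
    exact nonneg_of_mul_nonneg_right h (by positivity)
  exists_mul := by
    rintro ⟨b, m, hb⟩ γ h0 h1
    change slope γ ≤ slope (deg b) at h1
    -- Here g only carries the degree required of the left factor; it need not lie in the monoid.
    obtain ⟨g, hg⟩ := exists_deg_eq (deg b - γ)
    have hφ : 0 < (Real.goldenRatio ^ 2) ^ m := by
      have := Real.goldenRatio_pos
      positivity
    obtain ⟨n, a, ha, c, hc, hac, hdeg⟩ := exists_split_closure hNS hN hx hy hS hb ((σ ^ m) g)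
      (by
        rw [slope_deg_σ_pow, hg, map_sub]
        exact mul_nonneg hφ.le (by linarith))
      (by
        rw [slope_deg_σ_pow, slope_deg_σ_pow, hg, map_sub]
        exact mul_le_mul_of_nonneg_left (by linarith) hφ.le)
    rw [← MulAut.mul_apply, ← pow_add] at hac hdeg
    obtain ⟨a, rfl⟩ := (σ ^ (n + m)).surjective a
    obtain ⟨c, rfl⟩ := (σ ^ (n + m)).surjective c
    rw [deg_σ_pow_eq_iff] at hdeg
    rw [← map_mul] at hac
    have hbac := (σ ^ (n + m)).injective hac
    have hidx := startIndex_eq (hNM hc)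
    obtain ⟨h2, h3⟩ := hstart _ hc
    rw [← hidx] at h2 h3
    refine ⟨⟨a * z ^ startIndex c, n + m, ?_⟩, ⟨z ^ (-startIndex c) * c, n + m, ?_⟩, ?_, ?_, ?_⟩
    · rw [map_mul, σ_pow_z_zpow]
      exact mul_mem ha h2
    · rw [map_mul, σ_pow_z_zpow]
      exact h3
    · change startIndex (z ^ (-startIndex c) * c) = 0
      rw [startIndex_zpow_mul (hNM hc)]
      simp
    · change deg (z ^ (-startIndex c) * c) = γ
      rw [hbac, deg_mul, hdeg] at hg
      rw [deg_mul, deg_zpow, zero_add]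
      rwa [add_sub_assoc, left_eq_add, sub_eq_zero] at hg
    · apply Subtype.ext
      change a * z ^ startIndex c * (z ^ (-startIndex c) * c) = b
      rw [hbac]
      group
  eq_of_mul_eq := by
    rintro ⟨a, m₁, ha⟩ ⟨a', m₂, ha'⟩ ⟨c, m₃, hc⟩ ⟨c', m₄, hc'⟩ h1 h2 hdeg heq
    change startIndex c = 0 at h1
    change startIndex c' = 0 at h2
    change deg c = deg c' at hdeg
    have heq' : a * c = a' * c' := congrArg Subtype.val heq
    set n := max (max m₁ m₂) (max m₃ m₄) with hn
    have lift : ∀ {g : CedoG} {m : ℕ}, m ≤ n → (σ ^ m) g ∈ N → (σ ^ n) g ∈ M₁ :=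
      fun hmn hg => hNM (σ_pow_mem hN hmn hg)
    have hc₁ : (σ ^ n) c ∈ M₁ := lift (by omega) hc
    have hc₁' : (σ ^ n) c' ∈ M₁ := lift (by omega) hc'
    have hdega : deg a = deg a' := by
      have := congrArg deg heq'
      rw [deg_mul, deg_mul, hdeg] at this
      exact add_right_cancel this
    obtain ⟨k, hk⟩ := exists_zpow_of_mul_eq (lift (by omega) ha) (lift (by omega) ha') hc₁ hc₁'
      ((deg_σ_pow_eq_iff n).2 hdega) (by rw [← map_mul, ← map_mul, heq'])
    rw [← σ_pow_z_zpow n k, ← map_mul] at hk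
    rw [(σ ^ n).injective hk, mul_assoc, mul_right_inj] at heq'
    have hk0 := startIndex_zpow_mul hc₁' k
    rw [← heq', h1, h2, add_zero] at hk0
    rw [← hk0, zpow_zero, one_mul] at heq'
    exact Subtype.ext heq'
  mul_mem := by
    rintro ⟨c, n, hc⟩ h1 hdeg
    have := startIndex_mul_zpow (hNM hc) hdeg 1
    rw [zpow_one] at this
    exact this.trans h1
  degree_z := deg_z
  index_mul := by
    rintro ⟨c, hc⟩
    change latticeFun (c * z) (deg (c * z)) = latticeFun c (deg c) + 1
    rw [latticeFun_mul, deg_mul, deg_z, add_zero, sub_self, latticeFun_z, if_pos rfl]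
  exists_pow := by
    rintro ⟨c, n, hc⟩ hdeg
    change deg c = 0 at hdeg
    obtain ⟨k, hk⟩ := eq_zpow_of_deg_eq_zero (hNM hc) (by
      rw [← deg_one, ← map_one (σ ^ n), deg_σ_pow_eq_iff, deg_one, hdeg])
    rw [← σ_pow_z_zpow n k] at hk
    -- Multiplying by z ^ |k| makes the exponent k + |k| nonnegative whatever the sign of k.
    refine ⟨k.natAbs, (k + k.natAbs).toNat, Subtype.ext ?_⟩
    change c * z ^ k.natAbs = z ^ (k + k.natAbs).toNat
    rw [(σ ^ n).injective hk, ← zpow_natCast, ← zpow_natCast, ← zpow_add,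
      Int.toNat_of_nonneg (by omega)]

end CedoG

theorem lemmaL (D : Type*) [DivisionRing D] (M : Submonoid CedoG)
    (hM : M = CedoG.Mlim₀ ∨ M = CedoG.Mlim₁) :
    IsHomogeneousSemifir (homogeneousComponent D (CedoG.δ.comp M.subtype)) := by
  open CedoG in
  rcases hM with rfl | rfl
  · refine (isCyclicTransversal (N := M₀) rfl (fun _ => σ_mem_M₀) x_mem_M₀ y_mem_M₀
      ⟨0, z_mem_M₀⟩ ?_ M₀_le_M₁ fun c hc => ?_).isHomogeneousSemifir D
    · rintro _ (rfl | rfl | rfl) <;> simp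
    -- In M₀ the leading exponent of z is a natural number, so both the power and the remaining
    -- factor stay in M₀.
    · rcases exists_first_letter_M₀ hc with ⟨k, rfl⟩ | ⟨k, l, hl, c', hc', rfl⟩
      · rw [← zpow_natCast, latticeFun_zpow, if_pos rfl, zpow_natCast, ← zpow_natCast, ← zpow_add]
        simpa using pow_mem z_mem_M₀ k
      · have h := latticeFun_zpow_mul_letter_mul k hl (M₀_le_M₁ hc')
        rw [zpow_natCast] at h
        rw [h, zpow_natCast, mul_assoc (z ^ k), zpow_neg, zpow_natCast, inv_mul_cancel_left]
        refine ⟨pow_mem z_mem_M₀ k, mul_mem ?_ hc'⟩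
        rcases hl with rfl | rfl
        exacts [x_mem_M₀, y_mem_M₀]
  · refine (isCyclicTransversal (N := M₁) rfl (fun _ => σ_mem_M₁) x_mem_M₁ y_mem_M₁
      ⟨0, z_mem_M₁⟩ ?_ le_rfl fun c hc => ?_).isHomogeneousSemifir D
    · rintro _ (rfl | rfl | rfl | rfl) <;> simp
    · exact ⟨z_zpow_mem_M₁ _, mul_mem (z_zpow_mem_M₁ _) hc⟩
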